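/- **Setting.** Let $\kappa_m,\varepsilon>0$ and let $\gamma_1,\dots,\gamma_M$ be $C^1$ curves in $\mathbb R^2$ parametrized by arc length. Each is either closed (a periodic map $\mathbb R\to\mathbb R^2$) or is defined on a closed, possibly unbounded, interval; the boundary points of that interval, if any, give the endpoints of the curve. Assume: 1. (Curvature.) For each $\gamma_i=(x_i,y_i)$, at all parameters except possibly countably many, the second derivative exists and $|x_i'y_i''-y_i'x_i''|/(x_i'^2+y_i'^2)^{3/2}\le\kappa_m$. 2. (Separation.) $|\gamma_i(t)-\gamma_j(t')|\ge\delta$ for all $i\ne j$ and all $t,t'$; and $|\gamma_i(t)-\gamma_i(t')|\ge\delta$ whenever the arc length between the two points along $\gamma_i$ (for a closed curve: the length of the shorter of the two arcs) exceeds $\pi/(2\kappa_m)$. 3. (Endpoints.) Any two endpoints of curves of the figure, if they belong to different curves, or are the two endpoints of one curve of length more than $\pi/(2\kappa_m)$, are at distance more than $\varepsilon$. (This is void if no curve has endpoints, for instance if all curves are closed.) Let $p_1,\dots,p_N$ be distinct points on the curves and let $m_i$ be a unit tangent vector, of either orientation, at $p_i$ to the curve through $p_i$. Two distinct samples are *adjacent*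 if they bound an arc of some $\gamma_k$ that contains no sample in its interior. The *polygonalization* is the graph with vertices $p_1,\dots,p_N$ whose edges join exactly the adjacent pairs; to be a polygonalization this graph must also be plane when its edges are drawn as straight segments (two edges meet only in common endpoints, and no edge contains a vertex other than its two ends). **Algorithm.** Let $v^\perp$ be $v$ rotated clockwise by $\pi/2$ and let $B_r(x)$ be the open ball. The allowed zone of $p_i$ is $$A_\varepsilon(p_i)=B_\varepsilon(p_i)\setminus\bigcup_{\pm}B_{\kappa_m^{-1}}\bigl(p_i\pm\kappa_m^{-1}m_i^\perp\bigr).$$ (1) Let $E=\{(p_i,p_j): p_i\in A_\varepsilon(p_j)\text{ and }p_j\in A_\varepsilon(p_i)\}$. (2) For each $i$ and each sign let $R_i^\pm=\{p_j:(p_i,p_j)\in E,\ \pm(p_j-p_i)\cdot m_i>0\}$ and, if this set is non-empty, let $r_i^\pm$ be an element $q\in R_i^\pm$ minimizing $|(q-p_i)\cdot m_i|$. (3) Return the graph on $p_1,\dots,p_N$ with edges $\{p_i,r_i^+\}$ and $\{p_i,r_i^-\}$, for all $i$ for which they are defined. **Theorem.** Suppose that $\delta>2\kappa_m\varepsilon^2$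 and $\varepsilon<\dfrac1{\kappa_m\sqrt2}$, and that every arc of a curve $\gamma_k$ between consecutive samples has length less than $\varepsilon$. Then the graph returned by the algorithm (however ties in step 2 are broken) is exactly the polygonalization of the figure. If these arcs are only assumed to have length at most $\varepsilon$, the same holds for the algorithm in which $B_\varepsilon(p_i)$ in the definition of $A_\varepsilon(p_i)$ is the closed ball, the balls of radius $\kappa_m^{-1}$ remaining open. -/

import Mathlib

/-- The Euclidean plane. -/
abbrev Plane : Type := EuclideanSpace ℝ (Fin 2)

/-- The vector `v` rotated clockwise by the angle `π / 2`. -/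
noncomputable def perp (v : Plane) : Plane := !₂[v 1, -v 0]

/-- A `C¹` plane curve parametrized by arc length. The parameter set `dom` is a closed interval,
bounded or not; a parameter in its frontier is an endpoint of the curve. A closed curve is a curve
with `dom = ℝ` and `period > 0`; every other curve has `period = 0`. -/
structure PlaneCurve where
  /-- the parametrization; only its values on `dom` matter -/
  toFun : ℝ → Plane
  /-- the parameter interval -/
  dom : Set ℝ
  /-- the period of a closed curve, and `0` for any other curve -/
  period : ℝ
  dom_isClosed : IsClosed dom
  dom_ordConnected : dom.OrdConnected
  contDiffOn : ContDiffOn ℝ 1 toFun dom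
  unit_speed : ∀ t ∈ dom, ‖derivWithin toFun dom t‖ = 1
  period_nonneg : 0 ≤ period
  dom_eq_univ_of_period_pos : 0 < period → dom = Set.univ
  periodic : Function.Periodic toFun period

namespace PlaneCurve

/-- The tangent `γ'(t)` (one-sided at an endpoint). -/
noncomputable def tangent (c : PlaneCurve) (t : ℝ) : Plane :=
  derivWithin c.toFun c.dom t

/-- The second derivative `γ''(t)`. -/
noncomputable def accel (c : PlaneCurve) (t : ℝ) : Plane :=
  derivWithin c.tangent c.dom t

/-- The curvature `|x' y'' - y' x''| / (x'² + y'²)^(3/2)`. -/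
noncomputable def curvature (c : PlaneCurve) (t : ℝ) : ℝ :=
  |c.tangent t 0 * c.accel t 1 - c.tangent t 1 * c.accel t 0| /
    ((c.tangent t 0) ^ 2 + (c.tangent t 1) ^ 2) ^ (3 / 2 : ℝ)

/-- The curvature exists and is at most `κ` at all parameters, up to countably many exceptions
(such as the junctions of a piecewise `C²` curve). -/
def CurvatureLE (c : PlaneCurve) (κ : ℝ) : Prop :=
  ∃ S : Set ℝ, S.Countable ∧ ∀ t ∈ c.dom, t ∉ S →
    DifferentiableWithinAt ℝ c.tangent c.dom t ∧ c.curvature t ≤ κ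

/-- The points with parameters `s` and `t` are more than `r` apart along the curve; on a closed
curve this refers to both arcs between them. -/
def FarAlong (c : PlaneCurve) (r s t : ℝ) : Prop :=
  ∀ n : ℤ, r < |s - t + n * c.period|

/-- `s < t` are parameters of consecutive samples of the curve, where `P` is the set of all
sample points; `t - s` is the arc length between them. -/
def Consecutive (c : PlaneCurve) (P : Set Plane) (s t : ℝ) : Prop :=
  s ∈ c.dom ∧ t ∈ c.dom ∧ s < t ∧ c.toFun s ∈ P ∧ c.toFun t ∈ P ∧
    ∀ u ∈ Set.Ioo s t, c.toFun u ∉ P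

end PlaneCurve

/-- Distinct curves of the figure are at distance at least `δ`, and so are points of the same
curve that are more than `π / (2 κ)` apart along it. -/
def FigureSeparated {M : ℕ} (γ : Fin M → PlaneCurve) (κ δ : ℝ) : Prop :=
  (∀ k l, k ≠ l → ∀ s ∈ (γ k).dom, ∀ t ∈ (γ l).dom,
    δ ≤ dist ((γ k).toFun s) ((γ l).toFun t)) ∧
  ∀ k, ∀ s ∈ (γ k).dom, ∀ t ∈ (γ k).dom, (γ k).FarAlong (Real.pi / 2 * κ⁻¹) s t →
    δ ≤ dist ((γ k).toFun s) ((γ k).toFun t)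

/-- Any two endpoints of curves of the figure are more than `ε` apart, unless they are the
endpoints of one curve of length at most `π / (2 κ)`. This is void if no curve has endpoints. -/
def EndpointsSeparated {M : ℕ} (γ : Fin M → PlaneCurve) (κ ε : ℝ) : Prop :=
  ∀ k l, ∀ s ∈ frontier (γ k).dom, ∀ t ∈ frontier (γ l).dom,
    (k ≠ l ∨ (γ k).FarAlong (Real.pi / 2 * κ⁻¹) s t) →
      ε < dist ((γ k).toFun s) ((γ l).toFun t)

/-- The `p i` are distinct points of the figure, and `m i` is a unit tangent of the figure at
`p i`, with an arbitrary orientation. -/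
def IsSampleOf {M N : ℕ} (γ : Fin M → PlaneCurve) (p m : Fin N → Plane) : Prop :=
  Function.Injective p ∧ ∀ i, ∃ k, ∃ t ∈ (γ k).dom, (γ k).toFun t = p i ∧
    (m i = (γ k).tangent t ∨ m i = -(γ k).tangent t)

/-- The graph `Γ` on the vertices `p i`, with edges drawn as straight segments, is a plane graph:
two edges meet at most in common endpoints, and an edge contains no vertex but its own. -/
def IsPlaneGraph {N : ℕ} (p : Fin N → Plane) (Γ : SimpleGraph (Fin N)) : Prop :=
  Function.Injective p ∧
  (∀ a b c d, Γ.Adj a b → Γ.Adj c d → s(a, b) ≠ s(c, d) →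
    segment ℝ (p a) (p b) ∩ segment ℝ (p c) (p d) ⊆ {p a, p b} ∩ {p c, p d}) ∧
  ∀ a b v, Γ.Adj a b → p v ∈ segment ℝ (p a) (p b) → v = a ∨ v = b

/-- `Γ` is the polygonalization of the figure with respect to the samples `p`: a plane graph
whose vertices lie on the figure and whose edges join exactly the pairs of adjacent samples of
the curves. -/
def IsPolygonalization {M N : ℕ} (γ : Fin M → PlaneCurve) (p : Fin N → Plane)
    (Γ : SimpleGraph (Fin N)) : Prop :=
  IsPlaneGraph p Γ ∧
  (∀ i, ∃ k, ∃ t ∈ (γ k).dom, (γ k).toFun t = p i) ∧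
  ∀ i j, Γ.Adj i j ↔ i ≠ j ∧ ∃ k s t, (γ k).Consecutive (Set.range p) s t ∧
    ((γ k).toFun s = p i ∧ (γ k).toFun t = p j ∨ (γ k).toFun s = p j ∧ (γ k).toFun t = p i)

/-- The forbidden zone of the point `p` with unit tangent `m`. -/
def forbiddenZone (κ : ℝ) (p m : Plane) : Set Plane :=
  Metric.ball (p + κ⁻¹ • perp m) κ⁻¹ ∪ Metric.ball (p - κ⁻¹ • perp m) κ⁻¹

/-- The allowed zone of `p`: the ball `B p` about `p` without the forbidden zone. Here `B` assigns
to a point the (open or closed) ball of radius `ε` about it. -/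
def allowedZone (κ : ℝ) (B : Plane → Set Plane) (p m : Plane) : Set Plane :=
  B p \ forbiddenZone κ p m

/-- The distance of `p` and `q` in the direction `m`. -/
noncomputable def tangentialDist (m p q : Plane) : ℝ := |inner ℝ (p - q) m|

namespace NoiseFreePolygonalization

variable {N : ℕ} (κ : ℝ) (B : Plane → Set Plane) (p m : Fin N → Plane)

/-- Step 1: the edge relation of mutually allowed points. -/
def Edge (i j : Fin N) : Prop :=
  p i ∈ allowedZone κ B (p j) (m j) ∧ p j ∈ allowedZone κ B (p i) (m i)

/-- Step 2a: the set `R_i^±`, where the sign `±` is `σ = 1` or `σ = -1`. -/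
def candidates (σ : ℝ) (i : Fin N) : Set (Fin N) :=
  {j | Edge κ B p m i j ∧ 0 < σ * inner ℝ (p j - p i) (m i)}

/-- Step 2b: `r i` is a nearest tangential neighbour of `p i` in `R_i^±`, and `none` if
`R_i^±` is empty. -/
def IsArgmin (σ : ℝ) (r : Fin N → Option (Fin N)) : Prop :=
  ∀ i, (r i = none → candidates κ B p m σ i = ∅) ∧
    ∀ j, r i = some j → j ∈ candidates κ B p m σ i ∧
      ∀ l ∈ candidates κ B p m σ i,
        tangentialDist (m i) (p j) (p i) ≤ tangentialDist (m i) (p l) (p i)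

/-- Step 3: `Γ` is a graph that the algorithm may return, however ties in the choice of a nearest
tangential neighbour are broken. -/
def Returns (Γ : SimpleGraph (Fin N)) : Prop :=
  ∃ rpos rneg : Fin N → Option (Fin N),
    IsArgmin κ B p m 1 rpos ∧ IsArgmin κ B p m (-1) rneg ∧
      Γ = SimpleGraph.fromRel (fun i j => rpos i = some j ∨ rneg i = some j)

/-- The algorithm returns a graph, and whatever it returns is the polygonalization. -/
def Correct {M : ℕ} (γ : Fin M → PlaneCurve) : Prop :=
  (∃ Γ, Returns κ B p m Γ) ∧ ∀ Γ, Returns κ B p m Γ → IsPolygonalization γ p Γ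

end NoiseFreePolygonalization

open Real InnerProductGeometry Set

/-! The curvature bound makes the unit tangent turn by at most `κ` times the arc length. Integrating
this compares the curve with circular arcs of radius `κ⁻¹`: chords are no shorter, and normal
offsets no larger, than those of such an arc (`walk_bounds`, `sin_le_norm_chord`). Three
consequences give the theorem.

First, points at most `π / (2 κ)` apart along a curve avoid each other's forbidden zones, because
these are bounded by the extremal circles (`toFun_notMem_forbiddenZone`). Since `ε ≤ π / (4 κ)`,
adjacent samples are therefore joined in step 1.

Second, and this is the heart of the matter, step 1 joins only samples at most `π / (2 κ)` apart
along one curve (`exists_of_edge`). Suppose `P` and `Q` are mutually allowed but lie on separated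
pieces. Each lies near the tangent line at the other, so each curve, followed towards the other
point, would pass it at distance below `δ` unless it ended first. Hence both end early, each inside
a narrow cone about the line `PQ`. Either the two ends have not yet passed each other, and then they
are at most `ε` apart, or the curves come level somewhere at distance below `δ`. Both are excluded
(`not_apart_of_mutually_allowed`).

Third, along an arc of length at most `π / (2 κ)` the coordinate in the direction of the initial
tangent strictly increases (`inner_tangent_pos`). So the candidates on one side of a sample are
ordered by tangential distance as they are along the curve, and the nearest one is the next sample.

Planarity uses the same monotonicity. A chord stays within `κ ε² / 2` of its arc, so if two chords
meet, their arcs lie on one piece of length at most `π / κ`. Projection to the tangent at the middle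
of this piece separates the chords.

The open and the closed ball are treated together: only the weak bound `ε` on gaps and distances is
needed, and that adjacent samples lie in each other's balls. -/

/-- A mean value inequality for functions that are differentiable off a countable set. -/
theorem norm_sub_le_of_hasDerivAt_off_countable {E : Type*} [NormedAddCommGroup E]
    [NormedSpace ℝ E] [CompleteSpace E] {f : ℝ → E} {a b K : ℝ} {S : Set ℝ} (hab : a ≤ b)
    (hS : S.Countable) (hc : ContinuousOn f (Icc a b))
    (hd : ∀ x ∈ Ioo a b \ S, DifferentiableAt ℝ f x ∧ ‖deriv f x‖ ≤ K) :
    ‖f b - f a‖ ≤ K * (b - a) := by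
  have hae : ∀ᵐ x, x ∈ uIoc a b → ‖deriv f x‖ ≤ K := by
    have h0 : MeasureTheory.volume (S ∪ {b}) = 0 :=
      (hS.union (countable_singleton b)).measure_zero _
    filter_upwards [MeasureTheory.compl_mem_ae_iff.2 h0] with x hx hxI
    rw [uIoc_of_le hab] at hxI
    simp only [mem_compl_iff, mem_union, mem_singleton_iff, not_or] at hx
    exact (hd x ⟨⟨hxI.1, lt_of_le_of_ne hxI.2 hx.2⟩, hx.1⟩).2
  -- The derivative is always measurable and is bounded almost everywhere, so it is integrable and
  -- the fundamental theorem with countably many exceptions applies.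
  have hint : IntervalIntegrable (deriv f) MeasureTheory.volume a b := by
    refine (intervalIntegrable_const (c := K)).mono_fun
      (stronglyMeasurable_deriv f).aestronglyMeasurable ?_
    rw [Filter.EventuallyLE, MeasureTheory.ae_restrict_iff' measurableSet_uIoc]
    filter_upwards [hae] with x hx hxI
    exact (hx hxI).trans (le_abs_self K)
  rw [← MeasureTheory.integral_eq_of_hasDerivAt_off_countable_of_le f (deriv f) hab hS hc
    (fun x hx => (hd x hx).1.hasDerivAt) hint]
  have := intervalIntegral.norm_integral_le_of_norm_le_const_ae hae
  rwa [abs_of_nonneg (sub_nonneg.2 hab)] at this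

/-! ### Plane geometry -/

namespace Plane

theorem inner_eq (v w : Plane) : inner ℝ v w = v 0 * w 0 + v 1 * w 1 := by
  simp [PiLp.inner_apply, Fin.sum_univ_two, mul_comm]

theorem norm_sq_eq (v : Plane) : ‖v‖ ^ 2 = v 0 ^ 2 + v 1 ^ 2 := by
  rw [← real_inner_self_eq_norm_sq, inner_eq]; ring

theorem perp_zero (v : Plane) : perp v 0 = v 1 := rfl

theorem perp_one (v : Plane) : perp v 1 = -v 0 := rfl

theorem norm_perp (v : Plane) : ‖perp v‖ = ‖v‖ := by
  have h : ‖perp v‖ ^ 2 = ‖v‖ ^ 2 := by simp only [norm_sq_eq, perp_zero, perp_one]; ring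
  exact (pow_left_inj₀ (norm_nonneg _) (norm_nonneg _) two_ne_zero).1 h

theorem perp_neg (v : Plane) : perp (-v) = -perp v := by
  ext i; fin_cases i <;> simp [perp]

theorem inner_sq_add_inner_perp_sq (v e : Plane) (he : ‖e‖ = 1) :
    (inner ℝ v e) ^ 2 + (inner ℝ v (perp e)) ^ 2 = ‖v‖ ^ 2 := by
  have h1 := norm_sq_eq e
  rw [he] at h1
  simp only [inner_eq, norm_sq_eq, perp_zero, perp_one]
  linear_combination (-(v 0 ^ 2 + v 1 ^ 2)) * h1

theorem cos_le_inner_of_angle_le {v w : Plane} {φ : ℝ} (hv : ‖v‖ = 1) (hw : ‖w‖ = 1)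
    (hφ : φ ≤ π) (h : angle v w ≤ φ) : cos φ ≤ inner ℝ v w := by
  rw [inner_eq_cos_angle_of_norm_eq_one hv hw]
  exact cos_le_cos_of_nonneg_of_le_pi (angle_nonneg _ _) hφ h

theorem abs_inner_perp_le_of_angle_le {v w : Plane} {φ : ℝ} (hv : ‖v‖ = 1) (hw : ‖w‖ = 1)
    (hφ : φ ≤ π / 2) (h : angle v w ≤ φ) : |inner ℝ v (perp w)| ≤ sin φ := by
  have h0 := angle_nonneg v w
  have hs : 0 ≤ sin φ := sin_nonneg_of_nonneg_of_le_pi (h0.trans h) (by linarith [pi_pos])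
  have hc : 0 ≤ cos φ := cos_nonneg_of_neg_pi_div_two_le_of_le (by linarith [pi_pos]) hφ
  refine abs_le_of_sq_le_sq ?_ hs
  have h1 := inner_sq_add_inner_perp_sq v w hw
  have h2 := cos_le_inner_of_angle_le hv hw (by linarith [pi_pos]) h
  rw [hv] at h1
  nlinarith [sin_sq_add_cos_sq φ]

/-- A point outside the forbidden zone is close to the tangent line. -/
theorem abs_inner_perp_le_of_notMem_forbiddenZone {κ : ℝ} (hκ : 0 < κ) {p q m : Plane}
    (hm : ‖m‖ = 1) (h : q ∉ forbiddenZone κ p m) :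
    |inner ℝ (q - p) (perp m)| ≤ κ / 2 * ‖q - p‖ ^ 2 := by
  have hn : ‖perp m‖ = 1 := (norm_perp m).trans hm
  simp only [forbiddenZone, mem_union, Metric.mem_ball, not_or, not_lt, dist_eq_norm] at h
  have hκ' : 0 < κ⁻¹ := inv_pos.2 hκ
  have e1 : ‖q - (p + κ⁻¹ • perp m)‖ ^ 2
      = ‖q - p‖ ^ 2 - 2 * (κ⁻¹ * inner ℝ (q - p) (perp m)) + κ⁻¹ ^ 2 := by
    rw [← sub_sub, norm_sub_sq_real, inner_smul_right, norm_smul, hn, norm_of_nonneg hκ'.le,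
      mul_one]
  have e2 : ‖q - (p - κ⁻¹ • perp m)‖ ^ 2
      = ‖q - p‖ ^ 2 + 2 * (κ⁻¹ * inner ℝ (q - p) (perp m)) + κ⁻¹ ^ 2 := by
    rw [← sub_add, norm_add_sq_real, inner_smul_right, norm_smul, hn, norm_of_nonneg hκ'.le,
      mul_one]
  have h1 := pow_le_pow_left₀ hκ'.le h.1 2
  have h2 := pow_le_pow_left₀ hκ'.le h.2 2
  rw [e1] at h1
  rw [e2] at h2
  have key : ∀ x : ℝ, 2 * (κ⁻¹ * x) ≤ ‖q - p‖ ^ 2 → x ≤ κ / 2 * ‖q - p‖ ^ 2 := by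
    intro x hx
    have := mul_le_mul_of_nonneg_left hx (half_pos hκ).le
    have h3 : κ / 2 * (2 * (κ⁻¹ * x)) = x := by field_simp
    linarith
  rw [abs_le]
  constructor
  · have := key (-inner ℝ (q - p) (perp m)) (by linarith)
    linarith
  · exact key _ (by linarith)

/-- Expanding the squared distances to the two centres shows that avoiding both disks is equivalent
to this quadratic bound on the normal coordinate; this is the converse direction. -/
theorem notMem_forbiddenZone {κ : ℝ} (hκ : 0 < κ) {p q m : Plane}
    (hm : ‖m‖ = 1) (h : |inner ℝ (q - p) (perp m)| ≤ κ / 2 * ‖q - p‖ ^ 2) :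
    q ∉ forbiddenZone κ p m := by
  have hn : ‖perp m‖ = 1 := (norm_perp m).trans hm
  simp only [forbiddenZone, mem_union, Metric.mem_ball, not_or, not_lt, dist_eq_norm]
  have hκ' : 0 < κ⁻¹ := inv_pos.2 hκ
  have e1 : ‖q - (p + κ⁻¹ • perp m)‖ ^ 2
      = ‖q - p‖ ^ 2 - 2 * (κ⁻¹ * inner ℝ (q - p) (perp m)) + κ⁻¹ ^ 2 := by
    rw [← sub_sub, norm_sub_sq_real, inner_smul_right, norm_smul, hn, norm_of_nonneg hκ'.le,
      mul_one]
  have e2 : ‖q - (p - κ⁻¹ • perp m)‖ ^ 2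
      = ‖q - p‖ ^ 2 + 2 * (κ⁻¹ * inner ℝ (q - p) (perp m)) + κ⁻¹ ^ 2 := by
    rw [← sub_add, norm_add_sq_real, inner_smul_right, norm_smul, hn, norm_of_nonneg hκ'.le,
      mul_one]
  have key : ∀ x : ℝ, x ≤ κ / 2 * ‖q - p‖ ^ 2 → 2 * (κ⁻¹ * x) ≤ ‖q - p‖ ^ 2 := by
    intro x hx
    have := mul_le_mul_of_nonneg_left hx (mul_pos two_pos hκ').le
    have h3 : 2 * κ⁻¹ * (κ / 2 * ‖q - p‖ ^ 2) = ‖q - p‖ ^ 2 := by field_simp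
    linarith
  rw [abs_le] at h
  have k1 := key _ h.2
  have k2 := key (-inner ℝ (q - p) (perp m)) (by linarith)
  constructor
  · exact le_of_sq_le_sq (by rw [e1]; linarith) (norm_nonneg _)
  · exact le_of_sq_le_sq (by rw [e2]; linarith) (norm_nonneg _)

theorem forbiddenZone_neg (κ : ℝ) (p m : Plane) : forbiddenZone κ p (-m) = forbiddenZone κ p m := by
  rw [forbiddenZone, forbiddenZone, perp_neg, smul_neg, sub_neg_eq_add, ← sub_eq_add_neg,
    union_comm]

end Plane

/-! ### Turning of curves of bounded curvature -/

namespace PlaneCurve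

variable {c : PlaneCurve} {κ : ℝ}

theorem Icc_subset_dom (c : PlaneCurve) {s t : ℝ} (hs : s ∈ c.dom) (ht : t ∈ c.dom) :
    Icc s t ⊆ c.dom := c.dom_ordConnected.out hs ht

theorem dom_mem_nhds (c : PlaneCurve) {s t u : ℝ} (hs : s ∈ c.dom) (ht : t ∈ c.dom)
    (hu : u ∈ Ioo s t) : c.dom ∈ nhds u :=
  Filter.mem_of_superset (Icc_mem_nhds hu.1 hu.2) (c.Icc_subset_dom hs ht)

/-- On a one-point domain `derivWithin` takes its default value `0`, contrary to unit speed. -/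
theorem dom_nontrivial (c : PlaneCurve) {t : ℝ} (ht : t ∈ c.dom) : c.dom.Nontrivial := by
  by_contra h
  rw [not_nontrivial_iff] at h
  have h1 : c.dom = {t} := h.eq_singleton_of_mem ht
  have h2 := c.unit_speed t ht
  rw [h1, derivWithin_zero_of_not_uniqueDiffWithinAt] at h2
  · simp at h2
  · rw [uniqueDiffWithinAt_iff_accPt, accPt_principal_iff_nhdsWithin]; simp

theorem uniqueDiffOn (c : PlaneCurve) : UniqueDiffOn ℝ c.dom := by
  rcases c.dom.eq_empty_or_nonempty with h | ⟨t, ht⟩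
  · rw [h]; exact uniqueDiffOn_empty
  · obtain ⟨a, ha, b, hb, hab⟩ := (c.dom_nontrivial ht).exists_lt
    refine uniqueDiffOn_convex c.dom_ordConnected.convex ⟨(a + b) / 2, ?_⟩
    rw [mem_interior_iff_mem_nhds]
    exact c.dom_mem_nhds ha hb ⟨by linarith, by linarith⟩

theorem norm_tangent (c : PlaneCurve) {t : ℝ} (ht : t ∈ c.dom) : ‖c.tangent t‖ = 1 :=
  c.unit_speed t ht

theorem continuousOn_tangent (c : PlaneCurve) : ContinuousOn c.tangent c.dom :=
  c.contDiffOn.continuousOn_derivWithin c.uniqueDiffOn le_rfl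

theorem continuousOn_toFun (c : PlaneCurve) : ContinuousOn c.toFun c.dom :=
  c.contDiffOn.continuousOn

theorem hasDerivAt_toFun (c : PlaneCurve) {s t u : ℝ} (hs : s ∈ c.dom) (ht : t ∈ c.dom)
    (hu : u ∈ Ioo s t) : HasDerivAt c.toFun (c.tangent u) u := by
  have h := c.dom_mem_nhds hs ht hu
  have h1 := (c.contDiffOn.differentiableOn one_ne_zero) u (mem_of_mem_nhds h)
  exact h1.hasDerivWithinAt.hasDerivAt h

theorem add_int_mul_period_mem (c : PlaneCurve) {s : ℝ} (hs : s ∈ c.dom) (n : ℤ) :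
    s + n * c.period ∈ c.dom := by
  rcases c.period_nonneg.eq_or_lt with h | h
  · rw [← h]; simpa using hs
  · rw [c.dom_eq_univ_of_period_pos h]; trivial

theorem toFun_add_int_mul_period (c : PlaneCurve) (s : ℝ) (n : ℤ) :
    c.toFun (s + n * c.period) = c.toFun s := c.periodic.int_mul n s

theorem tangent_add_int_mul_period (c : PlaneCurve) (s : ℝ) (n : ℤ) :
    c.tangent (s + n * c.period) = c.tangent s := by
  rcases c.period_nonneg.eq_or_lt with h | h
  · rw [← h]; simp
  · simp only [tangent, c.dom_eq_univ_of_period_pos h, derivWithin_univ]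
    rw [← deriv_comp_add_const]
    congr 1
    funext x
    exact c.toFun_add_int_mul_period x n

/-- The tangent has constant norm, so the acceleration is orthogonal to it and its norm is the
curvature. -/
theorem norm_accel_le (hκ : 0 ≤ κ) {t : ℝ} (ht : t ∈ c.dom)
    (hd : DifferentiableWithinAt ℝ c.tangent c.dom t) (h : c.curvature t ≤ κ) :
    ‖c.accel t‖ ≤ κ := by
  have h1 := c.norm_tangent ht
  have h2 : (c.tangent t 0) ^ 2 + (c.tangent t 1) ^ 2 = 1 := by
    rw [← Plane.norm_sq_eq, h1, one_pow]
  rw [curvature, h2, one_rpow, div_one] at h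
  have h3 : inner ℝ (c.accel t) (c.tangent t) = 0 := by
    have hi : HasDerivWithinAt (fun u => inner ℝ (c.tangent u) (c.tangent u)) 0 c.dom t :=
      (hasDerivWithinAt_const t c.dom (1 : ℝ)).congr
        (fun u hu => by rw [real_inner_self_eq_norm_sq, c.norm_tangent hu, one_pow])
        (by rw [real_inner_self_eq_norm_sq, h1, one_pow])
    have hi' := hd.hasDerivWithinAt.inner ℝ hd.hasDerivWithinAt
    have := (c.uniqueDiffOn t ht).eq_deriv _ hi hi'
    rw [real_inner_comm] at this
    change 0 = inner ℝ (c.accel t) (c.tangent t) + inner ℝ (c.accel t) (c.tangent t) at this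
    linarith
  have h4 := Plane.inner_sq_add_inner_perp_sq (c.accel t) _ h1
  rw [h3] at h4
  have h5 : inner ℝ (c.accel t) (perp (c.tangent t))
      = -(c.tangent t 0 * c.accel t 1 - c.tangent t 1 * c.accel t 0) := by
    simp only [Plane.inner_eq, Plane.perp_zero, Plane.perp_one]; ring
  rw [← abs_neg, ← h5] at h
  refine le_of_sq_le_sq ?_ hκ
  rw [← h4, ← sq_abs (inner ℝ (c.accel t) _)]
  nlinarith [abs_nonneg (inner ℝ (c.accel t) (perp (c.tangent t)))]

theorem norm_tangent_sub_le (hκ : 0 ≤ κ) (hc : c.CurvatureLE κ) {s t : ℝ} (hs : s ∈ c.dom)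
    (ht : t ∈ c.dom) (hst : s ≤ t) : ‖c.tangent t - c.tangent s‖ ≤ κ * (t - s) := by
  obtain ⟨S, hS, hSd⟩ := hc
  refine norm_sub_le_of_hasDerivAt_off_countable hst hS
    (c.continuousOn_tangent.mono (c.Icc_subset_dom hs ht)) fun u hu => ?_
  have hn := c.dom_mem_nhds hs ht hu.1
  have hu' := mem_of_mem_nhds hn
  obtain ⟨h1, h2⟩ := hSd u hu' hu.2
  refine ⟨h1.differentiableAt hn, ?_⟩
  have := norm_accel_le hκ hu' h1 h2
  rwa [accel, derivWithin_of_mem_nhds hn] at this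

/-- The chord between two unit vectors is twice the sine of half their angle. -/
theorem _root_.InnerProductGeometry.angle_le_two_mul_arcsin {E : Type*}
    [NormedAddCommGroup E] [InnerProductSpace ℝ E]
    {v w : E} {r : ℝ} (hv : ‖v‖ = 1) (hw : ‖w‖ = 1) (h : ‖v - w‖ ≤ r) :
    angle v w ≤ 2 * arcsin (r / 2) := by
  have h1 : ‖v - w‖ ^ 2 = (2 * sin (angle v w / 2)) ^ 2 := by
    rw [norm_sub_sq_real, hv, hw, inner_eq_cos_angle_of_norm_eq_one hv hw]
    have := cos_two_mul (angle v w / 2)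
    rw [show 2 * (angle v w / 2) = angle v w by ring] at this
    rw [this]
    nlinarith [sin_sq_add_cos_sq (angle v w / 2)]
  have h0 := angle_nonneg v w
  have h0' := angle_le_pi v w
  have h2 : 0 ≤ sin (angle v w / 2) :=
    sin_nonneg_of_nonneg_of_le_pi (by linarith) (by linarith)
  have h3 : ‖v - w‖ = 2 * sin (angle v w / 2) :=
    (pow_left_inj₀ (norm_nonneg _) (by linarith) two_ne_zero).1 h1
  have h4 : arcsin (sin (angle v w / 2)) ≤ arcsin (r / 2) :=
    arcsin_le_arcsin (by linarith)
  rw [arcsin_sin (by linarith) (by linarith)] at h4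
  linarith

/-- The tangent of a curve of curvature at most `κ` turns at most by `κ` times the arc length. -/
theorem angle_tangent_le_of_le (hκ : 0 ≤ κ) (hc : c.CurvatureLE κ) {s t : ℝ} (hs : s ∈ c.dom)
    (ht : t ∈ c.dom) (hst : s ≤ t) : angle (c.tangent s) (c.tangent t) ≤ κ * (t - s) := by
  -- A single chord estimate loses a factor. Subdividing into `n` equal pieces and adding the angles
  -- removes the loss as `n` tends to infinity, since `2 * arcsin (a * x)` has derivative `2 * a` at
  -- `0`.
  have hsub : ∀ n : ℕ, 0 < n →
      angle (c.tangent s) (c.tangent t) ≤ n * (2 * arcsin (κ * (t - s) / 2 / n)) := by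
    intro n hn
    have hn' : (0 : ℝ) < n := Nat.cast_pos.2 hn
    set h := (t - s) / n with hh
    have hh0 : 0 ≤ h := div_nonneg (by linarith) hn'.le
    have hnh : n * h = t - s := by rw [hh]; field_simp
    have hmem : ∀ k : ℕ, k ≤ n → s + k * h ∈ c.dom := by
      intro k hk
      refine c.Icc_subset_dom hs ht ⟨?_, ?_⟩
      · have : 0 ≤ k * h := by positivity
        linarith
      · have : (k : ℝ) * h ≤ n * h := by gcongr
        linarith
    have hk : ∀ k : ℕ, k ≤ n →
        angle (c.tangent s) (c.tangent (s + k * h)) ≤ k * (2 * arcsin (κ * (t - s) / 2 / n)) := by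
      intro k
      induction k with
      | zero =>
        intro _
        have : c.tangent s ≠ 0 := norm_ne_zero_iff.1 (by rw [c.norm_tangent hs]; simp)
        simp [angle_self this]
      | succ k ih =>
        intro hk
        have m1 := hmem k (by omega)
        have m2 := hmem (k + 1) hk
        have i1 := ih (by omega)
        have i2 := norm_tangent_sub_le hκ hc m1 m2 (by push_cast; linarith)
        rw [norm_sub_rev] at i2
        have i3 := angle_le_two_mul_arcsin (c.norm_tangent m1) (c.norm_tangent m2) i2
        have i4 := angle_le_angle_add_angle (c.tangent s) (c.tangent (s + k * h))
          (c.tangent (s + (k + 1 : ℕ) * h))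
        have i5 : κ * (s + (k + 1 : ℕ) * h - (s + k * h)) / 2 = κ * (t - s) / 2 / n := by
          rw [hh]; push_cast; field_simp; ring
        rw [i5] at i3
        push_cast at *
        linarith
    have := hk n le_rfl
    rwa [hnh, add_sub_cancel] at this
  have hlim : Filter.Tendsto (fun n : ℕ => (n : ℝ) * (2 * arcsin (κ * (t - s) / 2 / n)))
      Filter.atTop (nhds (κ * (t - s))) := by
    set a := κ * (t - s) / 2 with ha
    have hd : HasDerivAt (fun x : ℝ => 2 * arcsin (a * x)) (2 * a) 0 := by
      have h1 : HasDerivAt arcsin 1 (a * 0) := by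
        have := hasDerivAt_arcsin (x := 0) (by norm_num) (by norm_num)
        simpa using this
      have h2 := ((h1.comp (0 : ℝ) ((hasDerivAt_id (0 : ℝ)).const_mul a)).const_mul 2)
      simpa [Function.comp_def] using h2
    have h3 := (hasDerivAt_iff_tendsto_slope_zero.1 hd)
    have h4 : Filter.Tendsto (fun n : ℕ => ((n : ℝ))⁻¹) Filter.atTop (nhdsWithin 0 {0}ᶜ) := by
      refine tendsto_nhdsWithin_iff.2 ⟨tendsto_inv_atTop_nhds_zero_nat, ?_⟩
      filter_upwards [Filter.eventually_gt_atTop 0] with n hn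
      simp; omega
    have h5 := h3.comp h4
    have : κ * (t - s) = 2 * a := by rw [ha]; ring
    rw [this]
    refine h5.congr fun n => ?_
    simp [div_eq_mul_inv]
  refine ge_of_tendsto hlim ?_
  filter_upwards [Filter.eventually_gt_atTop 0] with n hn
  exact hsub n hn

theorem angle_tangent_le (hκ : 0 ≤ κ) (hc : c.CurvatureLE κ) {s t : ℝ} (hs : s ∈ c.dom)
    (ht : t ∈ c.dom) : angle (c.tangent s) (c.tangent t) ≤ κ * |t - s| := by
  rcases le_total s t with h | h
  · rw [abs_of_nonneg (sub_nonneg.2 h)]; exact angle_tangent_le_of_le hκ hc hs ht h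
  · rw [abs_sub_comm, abs_of_nonneg (sub_nonneg.2 h), angle_comm]
    exact angle_tangent_le_of_le hκ hc ht hs h

end PlaneCurve

/-! ### Comparison with circular arcs, walking in either direction `σ = ±1` -/

theorem le_of_hasDerivAt_nonneg {f f' : ℝ → ℝ} {a b : ℝ} (hab : a ≤ b)
    (hc : ContinuousOn f (Icc a b)) (hd : ∀ x ∈ Ioo a b, HasDerivAt f (f' x) x)
    (h0 : ∀ x ∈ Ioo a b, 0 ≤ f' x) : f a ≤ f b := by
  refine monotoneOn_of_deriv_nonneg (convex_Icc a b) hc ?_ ?_ (left_mem_Icc.2 hab)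
    (right_mem_Icc.2 hab) hab
  · rw [interior_Icc]
    exact fun x hx => (hd x hx).differentiableAt.differentiableWithinAt
  · rw [interior_Icc]
    exact fun x hx => (hd x hx).deriv ▸ h0 x hx

namespace PlaneCurve

variable {c : PlaneCurve} {κ : ℝ}

theorem add_mul_mem_dom (c : PlaneCurve) {s σ u v : ℝ} (hs : s ∈ c.dom) (hsu : s + σ * u ∈ c.dom)
    (hv : v ∈ Icc 0 u) : s + σ * v ∈ c.dom := by
  rcases le_total 0 σ with h | h
  · exact c.Icc_subset_dom hs hsu ⟨by nlinarith [hv.1, hv.2], by nlinarith [hv.1, hv.2]⟩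
  · exact c.Icc_subset_dom hsu hs ⟨by nlinarith [hv.1, hv.2], by nlinarith [hv.1, hv.2]⟩

theorem continuousOn_walk (c : PlaneCurve) {s σ u : ℝ} (hs : s ∈ c.dom)
    (hsu : s + σ * u ∈ c.dom) : ContinuousOn (fun v => c.toFun (s + σ * v)) (Icc 0 u) :=
  c.continuousOn_toFun.comp (by fun_prop) fun _ hv => c.add_mul_mem_dom hs hsu hv

theorem hasDerivAt_walk (c : PlaneCurve) {s σ u v : ℝ} (hσ : σ = 1 ∨ σ = -1) (hs : s ∈ c.dom)
    (hsu : s + σ * u ∈ c.dom) (hv : v ∈ Ioo 0 u) :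
    HasDerivAt (fun v => c.toFun (s + σ * v)) (σ • c.tangent (s + σ * v)) v := by
  have h1 : HasDerivAt c.toFun (c.tangent (s + σ * v)) (s + σ * v) := by
    rcases hσ with rfl | rfl
    · exact c.hasDerivAt_toFun hs hsu ⟨by linarith [hv.1], by linarith [hv.2]⟩
    · exact c.hasDerivAt_toFun hsu hs ⟨by linarith [hv.2], by linarith [hv.1]⟩
  have h2 : HasDerivAt (fun v => s + σ * v) σ v := by
    simpa using ((hasDerivAt_id v).const_mul σ).const_add s
  exact h1.scomp v h2

theorem norm_smul_tangent (c : PlaneCurve) {s σ : ℝ} (hσ : σ = 1 ∨ σ = -1) (hs : s ∈ c.dom) :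
    ‖σ • c.tangent s‖ = 1 := by
  rw [norm_smul, c.norm_tangent hs]
  rcases hσ with rfl | rfl <;> simp

theorem angle_walk_le (hκ : 0 < κ) (hc : c.CurvatureLE κ) {s σ α v : ℝ} {e : Plane}
    (hσ : σ = 1 ∨ σ = -1) (hs : s ∈ c.dom) (hsv : s + σ * v ∈ c.dom) (hv : 0 ≤ v)
    (hα : angle (σ • c.tangent s) e ≤ α) :
    angle (σ • c.tangent (s + σ * v)) e ≤ α + κ * v := by
  have h1 : angle (σ • c.tangent (s + σ * v)) (σ • c.tangent s) ≤ κ * v := by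
    have h2 := angle_tangent_le hκ.le hc hsv hs
    rw [show |s - (s + σ * v)| = v by
      rcases hσ with rfl | rfl
      · rw [show s - (s + 1 * v) = -v by ring, abs_neg, abs_of_nonneg hv]
      · rw [show s - (s + -1 * v) = v by ring, abs_of_nonneg hv]] at h2
    rcases hσ with rfl | rfl
    · simpa using h2
    · simpa [angle_neg_neg] using h2
  linarith [angle_le_angle_add_angle (σ • c.tangent (s + σ * v)) (σ • c.tangent s) e]

/-- Walking along a curve of curvature at most `κ`, starting at an angle of at most `α` to `e`, one
stays between the circular arcs that start at this angle and turn away from `e`. -/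
theorem walk_bounds (hκ : 0 < κ) (hc : c.CurvatureLE κ) {s σ α u : ℝ} {e : Plane}
    (hσ : σ = 1 ∨ σ = -1) (hs : s ∈ c.dom) (hsu : s + σ * u ∈ c.dom) (hu : 0 ≤ u) (he : ‖e‖ = 1)
    (hα : angle (σ • c.tangent s) e ≤ α) (h : α + κ * u ≤ π / 2) :
    (sin (α + κ * u) - sin α) / κ ≤ inner ℝ (c.toFun (s + σ * u) - c.toFun s) e ∧
      |inner ℝ (c.toFun (s + σ * u) - c.toFun s) (perp e)| ≤ (cos α - cos (α + κ * u)) / κ := by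
  -- After arc length `v` the velocity makes an angle of at most `α + κ * v` with `e`. Its
  -- components are thus controlled by the cosine and sine of this angle, and the claimed bounds are
  -- the antiderivatives vanishing at `0`.
  have hang : ∀ v ∈ Ioo 0 u, angle (σ • c.tangent (s + σ * v)) e ≤ α + κ * v ∧
      α + κ * v ≤ π / 2 ∧ ‖σ • c.tangent (s + σ * v)‖ = 1 := fun v hv =>
    have hm := c.add_mul_mem_dom hs hsu (Ioo_subset_Icc_self hv)
    ⟨angle_walk_le hκ hc hσ hs hm hv.1.le hα, by nlinarith [hv.2], c.norm_smul_tangent hσ hm⟩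
  have hcont := c.continuousOn_walk hs hsu
  have hin : ∀ w : Plane, ContinuousOn
      (fun v => inner ℝ (c.toFun (s + σ * v) - c.toFun s) w) (Icc 0 u) := fun w => by fun_prop
  have hder : ∀ w : Plane, ∀ v ∈ Ioo 0 u,
      HasDerivAt (fun v => inner ℝ (c.toFun (s + σ * v) - c.toFun s) w)
        (inner ℝ (σ • c.tangent (s + σ * v)) w) v := fun w v hv => by
    simpa using ((c.hasDerivAt_walk hσ hs hsu hv).sub_const (c.toFun s)).inner ℝ
      (hasDerivAt_const v w)
  have hlin : ∀ v, HasDerivAt (fun v => α + κ * v) κ v := fun v => by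
    simpa using ((hasDerivAt_id v).const_mul κ).const_add α
  have hsin : ∀ v, HasDerivAt (fun v => (sin (α + κ * v) - sin α) / κ) (cos (α + κ * v)) v :=
    fun v => by
      have := (((hlin v).sin).sub_const (sin α)).div_const κ
      rwa [mul_div_cancel_right₀ _ hκ.ne'] at this
  have hcos : ∀ v, HasDerivAt (fun v => (cos α - cos (α + κ * v)) / κ) (sin (α + κ * v)) v :=
    fun v => by
      have := (((hlin v).cos).const_sub (cos α)).div_const κ
      rwa [neg_mul, neg_neg, mul_div_cancel_right₀ _ hκ.ne'] at this
  have hcosc : ContinuousOn (fun v => (cos α - cos (α + κ * v)) / κ) (Icc 0 u) :=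
    fun v _ => (hcos v).continuousAt.continuousWithinAt
  have pi := pi_pos
  refine ⟨?_, abs_le.2 ⟨?_, ?_⟩⟩
  · have := le_of_hasDerivAt_nonneg hu
      ((hin e).sub (fun v _ => (hsin v).continuousAt.continuousWithinAt))
      (fun v hv => (hder e v hv).sub (hsin v)) fun v hv =>
        sub_nonneg.2 (Plane.cos_le_inner_of_angle_le (hang v hv).2.2 he
          (by linarith [(hang v hv).2.1]) (hang v hv).1)
    simp only [Pi.sub_apply, mul_zero, add_zero, sub_self, inner_zero_left,
      zero_div] at this
    linarith
  · have := le_of_hasDerivAt_nonneg hu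
      ((hin (perp e)).add hcosc)
      (fun v hv => (hder (perp e) v hv).add (hcos v)) fun v hv => by
        have := (abs_le.1 (Plane.abs_inner_perp_le_of_angle_le (hang v hv).2.2 he
          (hang v hv).2.1 (hang v hv).1)).1
        linarith
    simp only [Pi.add_apply, mul_zero, add_zero, sub_self, inner_zero_left,
      zero_div] at this
    linarith
  · have := le_of_hasDerivAt_nonneg hu
      (hcosc.sub (hin (perp e)))
      (fun v hv => (hcos v).sub (hder (perp e) v hv)) fun v hv => by
        have := (abs_le.1 (Plane.abs_inner_perp_le_of_angle_le (hang v hv).2.2 he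
          (hang v hv).2.1 (hang v hv).1)).2
        linarith
    simp only [Pi.sub_apply, mul_zero, add_zero, sub_self, inner_zero_left,
      zero_div] at this
    linarith

theorem walk_bounds_tangent (hκ : 0 < κ) (hc : c.CurvatureLE κ) {s σ u : ℝ}
    (hσ : σ = 1 ∨ σ = -1) (hs : s ∈ c.dom) (hsu : s + σ * u ∈ c.dom) (hu : 0 ≤ u)
    (h : κ * u ≤ π / 2) :
    sin (κ * u) / κ ≤ inner ℝ (c.toFun (s + σ * u) - c.toFun s) (σ • c.tangent s) ∧
      |inner ℝ (c.toFun (s + σ * u) - c.toFun s) (perp (σ • c.tangent s))| ≤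
        (1 - cos (κ * u)) / κ := by
  have h1 := c.norm_smul_tangent hσ hs
  have h2 : angle (σ • c.tangent s) (σ • c.tangent s) ≤ 0 :=
    (angle_self (norm_ne_zero_iff.1 (by rw [h1]; exact one_ne_zero))).le
  simpa using walk_bounds hκ hc hσ hs hsu hu h1 h2 (by simpa using h)

/-- Schur's comparison of a chord with the chord of a circular arc of the same length. -/
theorem sin_le_norm_chord (hκ : 0 < κ) (hc : c.CurvatureLE κ) {s t : ℝ} (hs : s ∈ c.dom)
    (ht : t ∈ c.dom) (h : κ * |t - s| ≤ π) :
    2 * sin (κ * |t - s| / 2) / κ ≤ ‖c.toFun t - c.toFun s‖ := by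
  wlog hst : s ≤ t generalizing s t
  · rw [abs_sub_comm, norm_sub_rev]
    exact this ht hs (by rwa [abs_sub_comm]) (le_of_not_ge hst)
  rw [abs_of_nonneg (sub_nonneg.2 hst)] at h ⊢
  -- Walking both ways from the midpoint, each half turns by at most `π / 2` and advances by at
  -- least `sin (κ * u) / κ` along the middle tangent.
  set u := (t - s) / 2 with hu
  have hm : (s + t) / 2 ∈ c.dom := c.Icc_subset_dom hs ht ⟨by linarith, by linarith⟩
  have e1 : (s + t) / 2 + 1 * u = t := by rw [hu]; ring
  have e2 : (s + t) / 2 + -1 * u = s := by rw [hu]; ring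
  have e3 : κ * (t - s) / 2 = κ * u := by rw [hu]; ring
  have w1 := (walk_bounds_tangent hκ hc (Or.inl rfl) hm (by rwa [e1]) (by linarith)
    (by linarith : κ * u ≤ π / 2)).1
  have w2 := (walk_bounds_tangent hκ hc (Or.inr rfl) hm (by rwa [e2]) (by linarith)
    (by linarith : κ * u ≤ π / 2)).1
  rw [e1] at w1
  rw [e2] at w2
  rw [e3]
  have h3 := real_inner_le_norm (c.toFun t - c.toFun s) (c.tangent ((s + t) / 2))
  rw [c.norm_tangent hm, mul_one] at h3
  rw [one_smul] at w1
  rw [neg_one_smul, inner_neg_right] at w2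
  have h4 : inner ℝ (c.toFun t - c.toFun s) (c.tangent ((s + t) / 2))
    = inner ℝ (c.toFun t - c.toFun ((s + t) / 2)) (c.tangent ((s + t) / 2))
      - inner ℝ (c.toFun s - c.toFun ((s + t) / 2)) (c.tangent ((s + t) / 2)) := by
    rw [← inner_sub_left]; congr 1; abel
  have h5 : 2 * sin (κ * u) / κ = sin (κ * u) / κ + sin (κ * u) / κ := by ring
  linarith

theorem norm_chord_pos (hκ : 0 < κ) (hc : c.CurvatureLE κ) {s t : ℝ} (hs : s ∈ c.dom)
    (ht : t ∈ c.dom) (hst : s ≠ t) (h : κ * |t - s| ≤ π) : 0 < ‖c.toFun t - c.toFun s‖ := by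
  have h0 : 0 < κ * |t - s| := mul_pos hκ (abs_pos.2 (sub_ne_zero.2 hst.symm))
  refine lt_of_lt_of_le (div_pos (mul_pos two_pos (sin_pos_of_pos_of_lt_pi ?_ ?_)) hκ)
    (sin_le_norm_chord hκ hc hs ht h) <;> linarith [pi_pos]

theorem norm_chord_le (c : PlaneCurve) {s t : ℝ} (hs : s ∈ c.dom) (ht : t ∈ c.dom) (hst : s ≤ t) :
    ‖c.toFun t - c.toFun s‖ ≤ t - s := by
  have := norm_sub_le_of_hasDerivAt_off_countable (K := 1) hst countable_empty
    (c.continuousOn_toFun.mono (c.Icc_subset_dom hs ht)) fun u hu =>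
      have hd := c.hasDerivAt_toFun hs ht hu.1
      ⟨hd.differentiableAt, by
        rw [hd.deriv, c.norm_tangent (c.Icc_subset_dom hs ht (Ioo_subset_Icc_self hu.1))]⟩
  linarith

/-- Nearby points of the curve lie outside the forbidden zone. -/
theorem toFun_notMem_forbiddenZone (hκ : 0 < κ) (hc : c.CurvatureLE κ) {s t : ℝ} (hs : s ∈ c.dom)
    (ht : t ∈ c.dom) (h : κ * |t - s| ≤ π / 2) :
    c.toFun t ∉ forbiddenZone κ (c.toFun s) (c.tangent s) := by
  have key : ∀ σ : ℝ, (σ = 1 ∨ σ = -1) → t = s + σ * |t - s| →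
      c.toFun t ∉ forbiddenZone κ (c.toFun s) (σ • c.tangent s) := by
    intro σ hσ he
    refine Plane.notMem_forbiddenZone hκ (c.norm_smul_tangent hσ hs) ?_
    have h1 := (walk_bounds_tangent hκ hc hσ hs (he ▸ ht) (abs_nonneg _) h).2
    have h2 := sin_le_norm_chord hκ hc hs ht (by linarith [pi_pos])
    rw [← he] at h1
    refine h1.trans ?_
    have h0 : 0 ≤ 2 * sin (κ * |t - s| / 2) / κ :=
      div_nonneg (mul_nonneg two_pos.le (sin_nonneg_of_nonneg_of_le_pi (by positivity)
        (by linarith [pi_pos]))) hκ.le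
    have h3 := pow_le_pow_left₀ h0 h2 2
    -- The comparison arc lies on the boundary of the forbidden zone, so its offset is exactly `κ /
    -- 2` times its squared chord. The curve has at most this offset and at least this chord.
    have h4 : (1 - cos (κ * |t - s|)) / κ = κ / 2 * (2 * sin (κ * |t - s| / 2) / κ) ^ 2 := by
      have := cos_two_mul (κ * |t - s| / 2)
      rw [show 2 * (κ * |t - s| / 2) = κ * |t - s| by ring] at this
      have h5 := sin_sq_add_cos_sq (κ * |t - s| / 2)
      field_simp
      rw [this]
      linarith
    rw [h4]
    gcongr
  rcases le_total s t with hst | hst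
  · simpa using key 1 (Or.inl rfl) (by rw [abs_of_nonneg (sub_nonneg.2 hst)]; ring)
  · have := key (-1) (Or.inr rfl) (by rw [abs_of_nonpos (sub_nonpos.2 hst)]; ring)
    rwa [neg_one_smul, Plane.forbiddenZone_neg] at this

/-- Strictly between `u` and `v` the tangent makes an acute angle with the tangent at `s`, so the
projection to the latter is strictly increasing. -/
theorem inner_tangent_pos (hκ : 0 < κ) (hc : c.CurvatureLE κ) {s u v : ℝ} (hs : s ∈ c.dom)
    (hu : u ∈ c.dom) (hv : v ∈ c.dom) (huv : u < v) (h1 : κ * |u - s| ≤ π / 2)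
    (h2 : κ * |v - s| ≤ π / 2) : 0 < inner ℝ (c.toFun v - c.toFun u) (c.tangent s) := by
  have hmono : StrictMonoOn (fun x => inner ℝ (c.toFun x) (c.tangent s)) (Icc u v) := by
    refine strictMonoOn_of_deriv_pos (convex_Icc u v) ?_ ?_
    · have := c.continuousOn_toFun.mono (c.Icc_subset_dom hu hv)
      fun_prop
    · rw [interior_Icc]
      intro x hx
      have hd : HasDerivAt (fun x => inner ℝ (c.toFun x) (c.tangent s))
          (inner ℝ (c.tangent x) (c.tangent s)) x := by
        simpa using (c.hasDerivAt_toFun hu hv hx).inner ℝ (hasDerivAt_const x (c.tangent s))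
      rw [hd.deriv]
      have hxd := c.Icc_subset_dom hu hv (Ioo_subset_Icc_self hx)
      have ha := angle_tangent_le hκ.le hc hxd hs
      have hlt : κ * |s - x| < π / 2 := by
        rw [← abs_of_pos hκ, ← abs_mul, abs_le] at h1 h2
        rw [← abs_of_pos hκ, ← abs_mul, abs_lt]
        constructor <;> nlinarith [hx.1, hx.2, h1.1, h2.2]
      refine lt_of_lt_of_le (cos_pos_of_mem_Ioo ⟨?_, hlt⟩)
        (Plane.cos_le_inner_of_angle_le (c.norm_tangent hxd) (c.norm_tangent hs) ?_ ha)
      · have : 0 ≤ κ * |s - x| := by positivity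
        linarith [pi_pos]
      · linarith [pi_pos]
  rw [inner_sub_left, sub_pos]
  exact hmono (left_mem_Icc.2 huv.le) (right_mem_Icc.2 huv.le) huv

/-! ### Chords near their arcs, and stability of being far along the curve -/

/-- A point on a chord is close to the arc over the chord. -/
theorem exists_norm_sub_le_of_mem_segment (hκ : 0 < κ) (hc : c.CurvatureLE κ) {s t : ℝ}
    (hs : s ∈ c.dom) (ht : t ∈ c.dom) (hst : s ≤ t) {x : Plane}
    (hx : x ∈ segment ℝ (c.toFun s) (c.toFun t)) :
    ∃ u ∈ Icc s t, dist x (c.toFun u) ≤ κ * (t - s) ^ 2 / 2 := by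
  -- Subtracting a linear motion does not change the offset between chord and arc at proportional
  -- parameters, and what remains has Lipschitz constant `κ * (t - s)`.
  have hlip : ∀ u v, s ≤ u → u ≤ v → v ≤ t →
      ‖(c.toFun v - v • c.tangent s) - (c.toFun u - u • c.tangent s)‖ ≤ κ * (t - s) * (v - u) := by
    intro u v hsu huv hvt
    have hu : u ∈ c.dom := c.Icc_subset_dom hs ht ⟨hsu, by linarith⟩
    have hv : v ∈ c.dom := c.Icc_subset_dom hs ht ⟨by linarith, hvt⟩
    refine norm_sub_le_of_hasDerivAt_off_countable
      (f := fun x => c.toFun x - x • c.tangent s) huv countable_empty ?_ fun x hx => ?_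
    · have := c.continuousOn_toFun.mono (c.Icc_subset_dom hu hv)
      fun_prop
    · have hd := (c.hasDerivAt_toFun hu hv hx.1).sub
        ((hasDerivAt_id x).smul_const (c.tangent s))
      rw [one_smul] at hd
      refine ⟨hd.differentiableAt, ?_⟩
      have := norm_tangent_sub_le hκ.le hc hs
        (c.Icc_subset_dom hu hv (Ioo_subset_Icc_self hx.1)) (by linarith [hx.1.1])
      have h2 : deriv (fun x => c.toFun x - x • c.tangent s) x = c.tangent x - c.tangent s :=
        hd.deriv
      rw [h2]
      refine this.trans ?_
      have := hx.1.2
      gcongr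
      linarith
  obtain ⟨a, b, ha, hb, hab, rfl⟩ := hx
  obtain rfl : a = 1 - b := by linarith
  refine ⟨s + b * (t - s), ⟨by nlinarith, by nlinarith⟩, ?_⟩
  set u := s + b * (t - s) with hu
  have h1 := hlip s u le_rfl (by nlinarith) (by nlinarith)
  have h2 := hlip u t (by nlinarith) (by nlinarith) le_rfl
  have e : (1 - b) • c.toFun s + b • c.toFun t - c.toFun u =
      b • ((c.toFun t - t • c.tangent s) - (c.toFun u - u • c.tangent s)) -
      (1 - b) • ((c.toFun u - u • c.tangent s) - (c.toFun s - s • c.tangent s)) := by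
    rw [hu]; module
  rw [dist_eq_norm, e]
  refine (norm_sub_le _ _).trans ?_
  rw [norm_smul, norm_smul, norm_of_nonneg ha, norm_of_nonneg hb]
  calc _ ≤ b * (κ * (t - s) * (t - u)) + (1 - b) * (κ * (t - s) * (u - s)) := by gcongr
    _ = κ * (t - s) ^ 2 * (2 * (b * (1 - b))) := by rw [hu]; ring
    _ ≤ κ * (t - s) ^ 2 * (1 / 2) := by
      gcongr
      nlinarith [sq_nonneg (2 * b - 1)]
    _ = _ := by ring

/-- Points that are far along the curve but close in the plane stay far along the curve when they
are moved a little. -/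
theorem FarAlong.of_near (hκ : 0 < κ) (hc : c.CurvatureLE κ) {ε s t s' t' : ℝ}
    (hε : ε < 1 / (κ * √2)) (hs : s ∈ c.dom) (ht : t ∈ c.dom)
    (hfar : c.FarAlong (π / 2 * κ⁻¹) s t) (hd : dist (c.toFun s) (c.toFun t) ≤ ε)
    (hs' : κ * |s' - s| ≤ π / 4) (ht' : κ * |t' - t| ≤ π / 4) :
    c.FarAlong (π / 2 * κ⁻¹) s' t' := by
  intro n
  have h1 := hfar n
  rw [← div_eq_mul_inv, div_lt_iff₀ hκ, mul_comm] at h1 ⊢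
  -- A chord over an arc of length between `π / (2 κ)` and `π / κ` is at least `√2 / κ`, which
  -- exceeds `ε`. So the arc is longer than `π / κ`, leaving room to move each end by `π / (4 κ)`.
  have h2 : π < κ * |s - t + n * c.period| := by
    by_contra! h2
    have e : s - t + n * c.period = (s + n * c.period) - t := by ring
    rw [e] at h1 h2
    have h3 := sin_le_norm_chord hκ hc ht (c.add_int_mul_period_mem hs n) h2
    rw [c.toFun_add_int_mul_period, ← dist_eq_norm] at h3
    have h4 : sin (π / 4) ≤ sin (κ * |s + n * c.period - t| / 2) :=
      sin_le_sin_of_le_of_le_pi_div_two (by linarith [pi_pos]) (by linarith) (by linarith)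
    have h5 : √2 / κ ≤ ε := by
      rw [sin_pi_div_four] at h4
      calc √2 / κ ≤ 2 * sin (κ * |s + n * c.period - t| / 2) / κ := by gcongr; linarith
        _ ≤ ε := h3.trans hd
    have h6 : 1 / (κ * √2) ≤ √2 / κ := by
      rw [div_le_div_iff₀ (by positivity) hκ]
      have : √2 * √2 = 2 := mul_self_sqrt (by norm_num)
      nlinarith
    linarith
  have h3 : |s - t + n * c.period| ≤ |s' - t' + n * c.period| + (|s' - s| + |t' - t|) := by
    have e : s - t + n * c.period = (s' - t' + n * c.period) + (-(s' - s) + (t' - t)) := by ring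
    rw [e]
    refine (abs_add_le _ _).trans (add_le_add_right ((abs_add_le _ _).trans ?_) _)
    rw [abs_neg]
  have h4 := mul_le_mul_of_nonneg_left h3 hκ.le
  linarith

/-- Otherwise the connected path would be split by two disjoint open sets, the interior of the
domain and its complement. -/
theorem exists_mem_frontier (c : PlaneCurve) {s σ U : ℝ} (hs : s ∈ c.dom) (hU : 0 ≤ U)
    (h : s + σ * U ∉ c.dom) : ∃ u ∈ Icc 0 U, s + σ * u ∈ frontier c.dom := by
  have hpre : IsPreconnected ((fun u => s + σ * u) '' Icc 0 U) :=
    isPreconnected_Icc.image _ (by fun_prop)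
  by_contra! hno
  obtain ⟨_, -, h1, h2⟩ := hpre (interior c.dom) c.domᶜ isOpen_interior
    c.dom_isClosed.isOpen_compl
    (by
      rintro _ ⟨u, hu, rfl⟩
      by_cases hd : s + σ * u ∈ c.dom
      · left
        by_contra hi
        exact hno u hu ⟨subset_closure hd, hi⟩
      · exact Or.inr hd)
    ⟨s, ⟨0, left_mem_Icc.2 hU, by simp⟩, by
      by_contra hi
      exact hno 0 (left_mem_Icc.2 hU) (by simpa using ⟨subset_closure hs, hi⟩)⟩
    ⟨s + σ * U, ⟨U, right_mem_Icc.2 hU, rfl⟩, h⟩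
  exact h2 (interior_subset h1)

theorem frontier_subset_dom (c : PlaneCurve) : frontier c.dom ⊆ c.dom :=
  c.dom_isClosed.frontier_subset

theorem abs_walk_sub {s σ u : ℝ} (hσ : σ = 1 ∨ σ = -1) (hu : 0 ≤ u) : |s + σ * u - s| = u := by
  rw [add_sub_cancel_left, abs_mul, abs_of_nonneg hu]
  rcases hσ with rfl | rfl <;> simp

/-! ### Mutually allowed points on separated pieces -/

/-- A curve that does not end too early passes near a point that lies close to one of its
tangents. -/
theorem exists_dist_walk_le (hκ : 0 < κ) (hc : c.CurvatureLE κ) {s σ ψ : ℝ} {Q : Plane}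
    (hσ : σ = 1 ∨ σ = -1) (hs : s ∈ c.dom) (hψ0 : 0 ≤ ψ) (hψ : ψ ≤ π / 4)
    (hsin : sin ψ = κ * ‖Q - c.toFun s‖) (hsU : s + σ * (ψ / κ) ∈ c.dom)
    (hpos : 0 ≤ inner ℝ (Q - c.toFun s) (σ • c.tangent s))
    (hperp : |inner ℝ (Q - c.toFun s) (perp (σ • c.tangent s))| ≤ κ / 2 * ‖Q - c.toFun s‖ ^ 2) :
    ∃ u ∈ Icc 0 (ψ / κ), dist (c.toFun (s + σ * u)) Q ≤ 3 / 2 * κ * ‖Q - c.toFun s‖ ^ 2 := by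
  have hU0 : 0 ≤ ψ / κ := div_nonneg hψ0 hκ.le
  have hκU : κ * (ψ / κ) = ψ := by field_simp
  have hT := c.norm_smul_tangent hσ hs
  set d := ‖Q - c.toFun s‖ with hd
  set e := σ • c.tangent s with he
  have hcont : ContinuousOn (fun v => inner ℝ (c.toFun (s + σ * v) - c.toFun s) e)
      (Icc 0 (ψ / κ)) := by
    have := c.continuousOn_walk hs hsU
    fun_prop
  -- The walk of length `ψ / κ` advances by at least `sin ψ / κ`, the distance to `Q`, so at some
  -- moment it is level with `Q`.
  obtain ⟨u, hu, hue⟩ : inner ℝ (Q - c.toFun s) e ∈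
      (fun v => inner ℝ (c.toFun (s + σ * v) - c.toFun s) e) '' Icc 0 (ψ / κ) := by
    refine intermediate_value_Icc hU0 hcont ⟨by simpa using hpos, ?_⟩
    have h1 := (walk_bounds_tangent hκ hc hσ hs hsU hU0 (by rw [hκU]; linarith [pi_pos])).1
    rw [hκU, hsin, mul_div_cancel_left₀ _ hκ.ne'] at h1
    have h2 := real_inner_le_norm (Q - c.toFun s) e
    rw [hT, mul_one] at h2
    exact h2.trans h1
  refine ⟨u, hu, ?_⟩
  have hκu : κ * u ≤ ψ := hκU ▸ mul_le_mul_of_nonneg_left hu.2 hκ.le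
  have h1 := (walk_bounds_tangent hκ hc hσ hs (c.add_mul_mem_dom hs hsU hu) hu.1
    (by linarith [pi_pos])).2
  have h2 := Plane.inner_sq_add_inner_perp_sq (c.toFun (s + σ * u) - Q) e hT
  have h3 : c.toFun (s + σ * u) - Q = (c.toFun (s + σ * u) - c.toFun s) - (Q - c.toFun s) := by
    abel
  have h4 : inner ℝ (c.toFun (s + σ * u) - Q) e = 0 := by
    rw [h3, inner_sub_left]
    exact sub_eq_zero.2 hue
  rw [h4, zero_pow two_ne_zero, zero_add, ← sq_abs, h3, inner_sub_left, ← h3] at h2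
  have h5 := (pow_left_inj₀ (abs_nonneg _) (norm_nonneg _) two_ne_zero).1 h2
  rw [dist_eq_norm, ← h5]
  -- Here `1 - cos ψ ≤ sin ψ ^ 2`. The remaining `κ / 2 * d ^ 2` of the final bound is the normal
  -- offset of `Q`.
  have h6 : (1 - cos (κ * u)) / κ ≤ κ * d ^ 2 := by
    have hcos : cos ψ ≤ cos (κ * u) :=
      cos_le_cos_of_nonneg_of_le_pi (mul_nonneg hκ.le hu.1) (by linarith [pi_pos]) hκu
    have hcos0 : 0 ≤ cos ψ := cos_nonneg_of_neg_pi_div_two_le_of_le (by linarith) (by linarith)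
    have hcos1 := cos_le_one ψ
    rw [div_le_iff₀ hκ]
    have : κ * d ^ 2 * κ = sin ψ ^ 2 := by rw [hsin]; ring
    rw [this]
    nlinarith [sin_sq_add_cos_sq ψ]
  have h7 := abs_sub (inner ℝ (c.toFun (s + σ * u) - c.toFun s) (perp e))
    (inner ℝ (Q - c.toFun s) (perp e))
  linarith

/-- A curve that starts in a direction close to `e` stays in a cone about `e`. -/
theorem walk_mem_cone (hκ : 0 < κ) (hc : c.CurvatureLE κ) {s σ ψ u : ℝ} {e : Plane}
    (hσ : σ = 1 ∨ σ = -1) (hs : s ∈ c.dom) (hψ : ψ ≤ π / 4) (he : ‖e‖ = 1)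
    (hang : angle (σ • c.tangent s) e ≤ ψ / 2) (hsu : s + σ * u ∈ c.dom) (hu : 0 ≤ u)
    (hκu : κ * u ≤ ψ) :
    0 ≤ inner ℝ (c.toFun (s + σ * u) - c.toFun s) e ∧
    |inner ℝ (c.toFun (s + σ * u) - c.toFun s) (perp e)| * cos ψ ≤
      inner ℝ (c.toFun (s + σ * u) - c.toFun s) e * sin ψ := by
  have hπ := pi_pos
  have hκu0 : 0 ≤ κ * u := mul_nonneg hκ.le hu
  obtain ⟨h1, h2⟩ := walk_bounds hκ hc hσ hs hsu hu he hang (by linarith)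
  have hsin0 : 0 ≤ sin ψ := sin_nonneg_of_nonneg_of_le_pi (by linarith) (by linarith)
  have hcos0 : 0 ≤ cos ψ := cos_nonneg_of_neg_pi_div_two_le_of_le (by linarith) (by linarith)
  have h3 : sin (ψ / 2) ≤ sin (ψ / 2 + κ * u) :=
    sin_le_sin_of_le_of_le_pi_div_two (by linarith) (by linarith) (by linarith)
  -- The comparison arc starting at angle `ψ / 2` has a chord of slope `tan (ψ / 2 + κ * u / 2)`, at
  -- most `tan ψ`. Cleared of denominators, this is the present inequality.
  have h4 : cos (ψ / 2) ≤ cos (ψ / 2 - κ * u) := by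
    rw [← cos_abs (ψ / 2 - κ * u)]
    exact cos_le_cos_of_nonneg_of_le_pi (abs_nonneg _) (by linarith)
      (abs_le.2 ⟨by linarith, by linarith⟩)
  have h5 : cos (ψ / 2) = cos ψ * cos (ψ / 2) + sin ψ * sin (ψ / 2) := by
    rw [← cos_sub]; congr 1; ring
  have h6 : cos (ψ / 2 - κ * u) = cos ψ * cos (ψ / 2 + κ * u) + sin ψ * sin (ψ / 2 + κ * u) := by
    rw [← cos_sub]; congr 1; ring
  refine ⟨(div_nonneg (sub_nonneg.2 h3) hκ.le).trans h1, ?_⟩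
  calc _ ≤ (cos (ψ / 2) - cos (ψ / 2 + κ * u)) / κ * cos ψ := by gcongr
    _ ≤ (sin (ψ / 2 + κ * u) - sin (ψ / 2)) / κ * sin ψ := by
      rw [div_mul_eq_mul_div, div_mul_eq_mul_div]
      gcongr ?_ / κ
      linarith
    _ ≤ _ := by gcongr

theorem _root_.Plane.exists_sign_inner_smul_nonneg (v w : Plane) :
    ∃ σ : ℝ, (σ = 1 ∨ σ = -1) ∧ 0 ≤ inner ℝ v (σ • w) := by
  rcases le_total 0 (inner ℝ v w : ℝ) with h | h
  · exact ⟨1, Or.inl rfl, by simpa using h⟩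
  · exact ⟨-1, Or.inr rfl, by simpa using h⟩

theorem _root_.Plane.abs_inner_perp_sign_smul {σ : ℝ} (hσ : σ = 1 ∨ σ = -1) (v w : Plane) :
    |inner ℝ v (perp (σ • w))| = |inner ℝ v (perp w)| := by
  rcases hσ with rfl | rfl
  · simp
  · rw [neg_one_smul, Plane.perp_neg, inner_neg_right, abs_neg]

/-- A point close to a tangent line is seen at a small angle to the tangent. -/
theorem _root_.Plane.angle_le_of_abs_inner_perp_le {κ ψ d : ℝ} {e T : Plane} (he : ‖e‖ = 1) (hT : ‖T‖ = 1)
    (hψ0 : 0 ≤ ψ) (hψ : ψ ≤ π / 4) (hsin : sin ψ = κ * d) (hd : 0 < d)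
    (hpos : 0 ≤ inner ℝ (d • e) T) (hperp : |inner ℝ (d • e) (perp T)| ≤ κ / 2 * d ^ 2) :
    angle T e ≤ ψ / 2 := by
  have hπ := pi_pos
  rw [real_inner_smul_left] at hpos hperp
  rw [abs_mul, abs_of_pos hd] at hperp
  have hp : 0 ≤ inner ℝ e T := nonneg_of_mul_nonneg_right hpos hd
  have hq : |inner ℝ e (perp T)| ≤ sin ψ / 2 := by
    rw [hsin]
    refine le_of_mul_le_mul_left ?_ hd
    linarith
  have h1 := Plane.inner_sq_add_inner_perp_sq e T hT
  rw [he] at h1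
  -- The sine of the angle is at most `sin ψ / 2 = sin (ψ / 2) * cos (ψ / 2)`, hence at most `sin (ψ
  -- / 2)`.
  have h2 : sin ψ = 2 * sin (ψ / 2) * cos (ψ / 2) := by
    rw [← sin_two_mul]; congr 1; ring
  have h3 := sin_sq_add_cos_sq (ψ / 2)
  have h4 : cos (ψ / 2) ≤ inner ℝ e T := by
    refine le_of_sq_le_sq ?_ hp
    have h5 := pow_le_pow_left₀ (abs_nonneg _) hq 2
    rw [sq_abs, h2] at h5
    nlinarith [mul_nonneg (sq_nonneg (sin (ψ / 2))) (sq_nonneg (sin (ψ / 2)))]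
  rw [angle, hT, he, mul_one, div_one, real_inner_comm]
  calc arccos (inner ℝ e T) ≤ arccos (cos (ψ / 2)) := arccos_le_arccos h4
    _ = ψ / 2 := arccos_cos (by linarith) (by linarith)

/-- Points in the mutual allowed zones cannot lie on pieces of curves that are at distance at least
`δ` and whose endpoints are more than `ε` apart. -/
theorem not_apart_of_mutually_allowed {c₁ c₂ : PlaneCurve} {δ ε s t : ℝ} (hκ : 0 < κ)
    (hc₁ : c₁.CurvatureLE κ) (hc₂ : c₂.CurvatureLE κ) (hδ : 2 * κ * ε ^ 2 < δ)
    (hεκ : ε < 1 / (κ * √2)) (hs : s ∈ c₁.dom) (ht : t ∈ c₂.dom)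
    (hne : c₁.toFun s ≠ c₂.toFun t) (hd : dist (c₁.toFun s) (c₂.toFun t) ≤ ε)
    (h₁ : c₂.toFun t ∉ forbiddenZone κ (c₁.toFun s) (c₁.tangent s))
    (h₂ : c₁.toFun s ∉ forbiddenZone κ (c₂.toFun t) (c₂.tangent t))
    (hA : ∀ s' ∈ c₁.dom, ∀ t' ∈ c₂.dom, κ * |s' - s| ≤ π / 4 → κ * |t' - t| ≤ π / 4 →
      δ ≤ dist (c₁.toFun s') (c₂.toFun t'))
    (hB : ∀ s' ∈ frontier c₁.dom, ∀ t' ∈ frontier c₂.dom, κ * |s' - s| ≤ π / 4 →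
      κ * |t' - t| ≤ π / 4 → ε < dist (c₁.toFun s') (c₂.toFun t')) : False := by
  have hπ := pi_pos
  have p₁ := Plane.abs_inner_perp_le_of_notMem_forbiddenZone hκ (c₁.norm_tangent hs) h₁
  have p₂ := Plane.abs_inner_perp_le_of_notMem_forbiddenZone hκ (c₂.norm_tangent ht) h₂
  set P := c₁.toFun s with hP
  set Q := c₂.toFun t with hQ
  set d := ‖Q - P‖ with hdd
  have hPQ : ‖P - Q‖ = d := norm_sub_rev _ _
  rw [hPQ] at p₂
  have hd0 : 0 < d := norm_pos_iff.2 (sub_ne_zero.2 hne.symm)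
  rw [dist_eq_norm, hPQ] at hd
  have ha0 : 0 < κ * d := mul_pos hκ hd0
  have ha : κ * d ≤ √2 / 2 := by
    have h2 : √2 * √2 = 2 := mul_self_sqrt (by norm_num)
    have : κ * (1 / (κ * √2)) = √2 / 2 := by field_simp; linarith
    rw [← this]
    exact mul_le_mul_of_nonneg_left (by linarith) hκ.le
  have hdε : κ * d ^ 2 ≤ κ * ε ^ 2 := by gcongr
  have hκd2 : 0 < κ * d ^ 2 := by positivity
  obtain ⟨ψ, hψ0, hψ, hsin⟩ : ∃ ψ, 0 ≤ ψ ∧ ψ ≤ π / 4 ∧ sin ψ = κ * d := by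
    refine ⟨arcsin (κ * d), arcsin_nonneg.2 ha0.le, ?_, sin_arcsin (by linarith) ?_⟩
    · rw [arcsin_le_iff_le_sin' ⟨by linarith, by linarith⟩, sin_pi_div_four]
      exact ha
    · have : √2 ≤ 2 := sqrt_le_iff.2 ⟨by norm_num, by norm_num⟩
      linarith
  have hU0 : 0 ≤ ψ / κ := div_nonneg hψ0 hκ.le
  have hκU : κ * (ψ / κ) = ψ := by field_simp
  have near : ∀ {r σ u : ℝ}, (σ = 1 ∨ σ = -1) → u ∈ Icc 0 (ψ / κ) →
      κ * |r + σ * u - r| ≤ π / 4 := fun hσ hu => by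
    rw [abs_walk_sub hσ hu.1]
    exact (mul_le_mul_of_nonneg_left hu.2 hκ.le).trans (by rwa [hκU])
  have near0 : ∀ r : ℝ, κ * |r - r| ≤ π / 4 := fun r => by
    rw [sub_self, abs_zero, mul_zero]; linarith
  obtain ⟨σ, hσ, sσ⟩ := Plane.exists_sign_inner_smul_nonneg (Q - P) (c₁.tangent s)
  obtain ⟨τ, hτ, sτ⟩ := Plane.exists_sign_inner_smul_nonneg (P - Q) (c₂.tangent t)
  rw [← Plane.abs_inner_perp_sign_smul hσ] at p₁
  rw [← Plane.abs_inner_perp_sign_smul hτ] at p₂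
  -- Both curves end before they have passed the other point.
  have n₁ : s + σ * (ψ / κ) ∉ c₁.dom := fun hmem => by
    obtain ⟨u, hu, hud⟩ := exists_dist_walk_le hκ hc₁ hσ hs hψ0 hψ hsin hmem sσ p₁
    have := hA _ (c₁.add_mul_mem_dom hs hmem hu) t ht (near hσ hu) (near0 t)
    change _ ≤ 3 / 2 * κ * d ^ 2 at hud
    linarith
  have n₂ : t + τ * (ψ / κ) ∉ c₂.dom := fun hmem => by
    rw [← hPQ] at p₂ hsin
    obtain ⟨u, hu, hud⟩ := exists_dist_walk_le hκ hc₂ hτ ht hψ0 hψ hsin hmem sτ p₂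
    have := hA s hs _ (c₂.add_mul_mem_dom ht hmem hu) (near0 s) (near hτ hu)
    change _ ≤ 3 / 2 * κ * ‖P - Q‖ ^ 2 at hud
    rw [hPQ, dist_comm] at hud
    linarith
  obtain ⟨u₁, hu₁, f₁⟩ := c₁.exists_mem_frontier hs hU0 n₁
  obtain ⟨u₂, hu₂, f₂⟩ := c₂.exists_mem_frontier ht hU0 n₂
  -- Coordinates along the line through the two points.
  set e : Plane := d⁻¹ • (Q - P) with he
  have hde : d • e = Q - P := by rw [he, smul_smul, mul_inv_cancel₀ hd0.ne', one_smul]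
  have hde' : d • (-e) = P - Q := by rw [smul_neg, hde, neg_sub]
  have he1 : ‖e‖ = 1 := by
    rw [he, norm_smul, norm_inv, norm_of_nonneg hd0.le]
    exact inv_mul_cancel₀ hd0.ne'
  have a₁ : angle (σ • c₁.tangent s) e ≤ ψ / 2 := by
    rw [← hde] at sσ p₁
    exact Plane.angle_le_of_abs_inner_perp_le he1 (c₁.norm_smul_tangent hσ hs) hψ0 hψ hsin hd0 sσ p₁
  have a₂ : angle (τ • c₂.tangent t) (-e) ≤ ψ / 2 := by
    rw [← hde'] at sτ p₂
    exact Plane.angle_le_of_abs_inner_perp_le (by rwa [norm_neg]) (c₂.norm_smul_tangent hτ ht) hψ0 hψ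
      hsin hd0 sτ p₂
  set X₁ : ℝ → ℝ := fun u => inner ℝ (c₁.toFun (s + σ * u) - P) e with hX₁
  set X₂ : ℝ → ℝ := fun u => inner ℝ (c₂.toFun (t + τ * u) - Q) (-e) with hX₂
  have m₁ := c₁.frontier_subset_dom f₁
  have m₂ := c₂.frontier_subset_dom f₂
  -- `X₁` and `X₂` measure the advances towards each other. Their sum shortens the gap along the
  -- line, and by the cone bounds its product with `tan ψ` bounds the sideways gap.
  have key : ∀ v₁ ∈ Icc 0 u₁, ∀ v₂ ∈ Icc 0 u₂,
      0 ≤ X₁ v₁ + X₂ v₂ ∧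
      inner ℝ (c₂.toFun (t + τ * v₂) - c₁.toFun (s + σ * v₁)) e = d - (X₁ v₁ + X₂ v₂) ∧
      |inner ℝ (c₂.toFun (t + τ * v₂) - c₁.toFun (s + σ * v₁)) (perp e)| * cos ψ ≤
        (X₁ v₁ + X₂ v₂) * sin ψ := by
    intro v₁ hv₁ v₂ hv₂
    have k₁ : κ * v₁ ≤ ψ := hκU ▸ mul_le_mul_of_nonneg_left (hv₁.2.trans hu₁.2) hκ.le
    have k₂ : κ * v₂ ≤ ψ := hκU ▸ mul_le_mul_of_nonneg_left (hv₂.2.trans hu₂.2) hκ.le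
    obtain ⟨x₁, y₁⟩ := walk_mem_cone hκ hc₁ hσ hs hψ he1 a₁ (c₁.add_mul_mem_dom hs m₁ hv₁) hv₁.1 k₁
    obtain ⟨x₂, y₂⟩ := walk_mem_cone hκ hc₂ hτ ht hψ (by rwa [norm_neg]) a₂
      (c₂.add_mul_mem_dom ht m₂ hv₂) hv₂.1 k₂
    have split : c₂.toFun (t + τ * v₂) - c₁.toFun (s + σ * v₁) =
        d • e + (c₂.toFun (t + τ * v₂) - Q) - (c₁.toFun (s + σ * v₁) - P) := by
      rw [hde]; abel
    have hee : inner ℝ e e = (1 : ℝ) := by rw [real_inner_self_eq_norm_sq, he1, one_pow]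
    have hep : inner ℝ e (perp e) = (0 : ℝ) := by
      simp only [Plane.inner_eq, Plane.perp_zero, Plane.perp_one]; ring
    refine ⟨add_nonneg x₁ x₂, ?_, ?_⟩
    · rw [split, inner_sub_left, inner_add_left, real_inner_smul_left, hee, hX₁, hX₂]
      simp only [inner_neg_right]
      ring
    · rw [split, inner_sub_left, inner_add_left, real_inner_smul_left, hep, mul_zero, zero_add]
      rw [Plane.perp_neg, inner_neg_right, abs_neg] at y₂
      have h3 := abs_sub (inner ℝ (c₂.toFun (t + τ * v₂) - Q) (perp e))
        (inner ℝ (c₁.toFun (s + σ * v₁) - P) (perp e))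
      have hcos0 : 0 ≤ cos ψ :=
        cos_nonneg_of_neg_pi_div_two_le_of_le (by linarith) (by linarith)
      have h4 := mul_le_mul_of_nonneg_right h3 hcos0
      rw [hX₁, hX₂]
      simp only
      linarith
  have hcos : √2 / 2 ≤ cos ψ := by
    rw [← cos_pi_div_four]
    exact cos_le_cos_of_nonneg_of_le_pi hψ0 (by linarith) hψ
  have hsqrt : 1 < √2 := by
    rw [lt_sqrt (by norm_num)]; norm_num
  rcases le_total (X₁ u₁ + X₂ u₂) d with hX | hX
  · -- The endpoints are too close.
    obtain ⟨q0, q1, q2⟩ := key u₁ (right_mem_Icc.2 hu₁.1) u₂ (right_mem_Icc.2 hu₂.1)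
    have h1 := hB _ f₁ _ f₂ (near hσ hu₁) (near hτ hu₂)
    have h2 := Plane.inner_sq_add_inner_perp_sq
      (c₂.toFun (t + τ * u₂) - c₁.toFun (s + σ * u₁)) e he1
    rw [q1, ← dist_eq_norm, dist_comm] at h2
    have h3 : |inner ℝ (c₂.toFun (t + τ * u₂) - c₁.toFun (s + σ * u₁)) (perp e)| ≤
        X₁ u₁ + X₂ u₂ := by
      refine le_of_mul_le_mul_right (q2.trans ?_) (by linarith : 0 < cos ψ)
      exact mul_le_mul_of_nonneg_left (by linarith) q0
    have h4 := pow_le_pow_left₀ (abs_nonneg _) h3 2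
    rw [sq_abs] at h4
    -- With `X` the total advance, `(d - X) ^ 2 + X ^ 2 ≤ d ^ 2` for `0 ≤ X ≤ d`.
    have h5 : dist (c₁.toFun (s + σ * u₁)) (c₂.toFun (t + τ * u₂)) ^ 2 ≤ d ^ 2 := by
      rw [← h2]; nlinarith
    have h6 := le_of_sq_le_sq h5 hd0.le
    linarith
  · -- The curves pass each other too closely.
    have hcont : ContinuousOn (fun v => X₁ (v * u₁) + X₂ (v * u₂)) (Icc 0 1) := by
      have hI : ∀ {w : ℝ}, 0 ≤ w → MapsTo (fun v => v * w) (Icc 0 1) (Icc 0 w) :=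
        fun hw v hv => ⟨mul_nonneg hv.1 hw, mul_le_of_le_one_left hw hv.2⟩
      have c1 : ContinuousOn X₁ (Icc 0 u₁) := by
        have := c₁.continuousOn_walk hs m₁
        fun_prop
      have c2 : ContinuousOn X₂ (Icc 0 u₂) := by
        have := c₂.continuousOn_walk ht m₂
        fun_prop
      exact (c1.comp (by fun_prop) (hI hu₁.1)).add (c2.comp (by fun_prop) (hI hu₂.1))
    obtain ⟨v, hv, hvd⟩ : d ∈ (fun v => X₁ (v * u₁) + X₂ (v * u₂)) '' Icc 0 1 := by
      refine intermediate_value_Icc zero_le_one hcont ⟨?_, by simpa using hX⟩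
      simp only [hX₁, hX₂, zero_mul, mul_zero, add_zero, hP, hQ, sub_self, inner_zero_left]
      exact hd0.le
    have w₁ : v * u₁ ∈ Icc 0 u₁ := ⟨mul_nonneg hv.1 hu₁.1, mul_le_of_le_one_left hu₁.1 hv.2⟩
    have w₂ : v * u₂ ∈ Icc 0 u₂ := ⟨mul_nonneg hv.1 hu₂.1, mul_le_of_le_one_left hu₂.1 hv.2⟩
    obtain ⟨q0, q1, q2⟩ := key _ w₁ _ w₂
    simp only at hvd
    rw [hvd] at q1 q2
    have h1 := hA _ (c₁.add_mul_mem_dom hs m₁ w₁) _ (c₂.add_mul_mem_dom ht m₂ w₂)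
      (near hσ ⟨w₁.1, w₁.2.trans hu₁.2⟩) (near hτ ⟨w₂.1, w₂.2.trans hu₂.2⟩)
    have h2 := Plane.inner_sq_add_inner_perp_sq
      (c₂.toFun (t + τ * (v * u₂)) - c₁.toFun (s + σ * (v * u₁))) e he1
    rw [q1, sub_self, zero_pow two_ne_zero, zero_add, ← sq_abs] at h2
    have h3 := (pow_left_inj₀ (abs_nonneg _) (norm_nonneg _) two_ne_zero).1 h2
    -- At this moment the gap is purely sideways, at most `d * tan ψ ≤ √2 * κ * d ^ 2`, which is
    -- below `2 * κ * ε ^ 2`.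
    rw [h3, ← dist_eq_norm, dist_comm, hsin] at q2
    have h4 : (0 : ℝ) ≤ dist (c₁.toFun (s + σ * (v * u₁))) (c₂.toFun (t + τ * (v * u₂))) :=
      dist_nonneg
    nlinarith

/-! ### Consecutive samples and successive chords -/

theorem exists_int_of_not_farAlong (hκ : 0 < κ) {s t : ℝ} (h : ¬c.FarAlong (π / 2 * κ⁻¹) s t) :
    ∃ n : ℤ, κ * |s - (t + n * c.period)| ≤ π / 2 := by
  simp only [FarAlong, not_forall, not_lt] at h
  obtain ⟨n, hn⟩ := h
  refine ⟨-n, ?_⟩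
  rw [← div_eq_mul_inv, le_div_iff₀ hκ, mul_comm] at hn
  rwa [show s - (t + (-n : ℤ) * c.period) = s - t + n * c.period by push_cast; ring]

theorem Consecutive.add_int_mul_period {P : Set Plane} {s t : ℝ} (h : c.Consecutive P s t) (n : ℤ) :
    c.Consecutive P (s + n * c.period) (t + n * c.period) := by
  obtain ⟨hs, ht, hst, hsP, htP, hno⟩ := h
  refine ⟨c.add_int_mul_period_mem hs n, c.add_int_mul_period_mem ht n, by linarith, ?_, ?_, ?_⟩
  · rwa [c.toFun_add_int_mul_period]
  · rwa [c.toFun_add_int_mul_period]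
  · intro u hu
    have := hno (u + (-n : ℤ) * c.period) (by
      push_cast
      exact ⟨by linarith [hu.1], by linarith [hu.2]⟩)
    rwa [c.toFun_add_int_mul_period] at this

/-- If the intervals overlapped without coinciding, an end of one would be a sample strictly inside
the other. -/
theorem Consecutive.eq_or_le_or_le {P : Set Plane} {s t s' t' : ℝ} (h : c.Consecutive P s t)
    (h' : c.Consecutive P s' t') : (s = s' ∧ t = t') ∨ t ≤ s' ∨ t' ≤ s := by
  obtain ⟨-, -, hst, hsP, htP, hno⟩ := h
  obtain ⟨-, -, hst', hsP', htP', hno'⟩ := h'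
  by_contra! hcon
  obtain ⟨h0, h1, h2⟩ := hcon
  rcases lt_trichotomy s s' with h3 | h3 | h3
  · exact hno s' ⟨h3, h1⟩ hsP'
  · rcases lt_trichotomy t t' with h4 | h4 | h4
    · exact hno' t ⟨h3 ▸ hst, h4⟩ htP
    · exact h0 h3 h4
    · exact hno t' ⟨h3 ▸ hst', h4⟩ htP'
  · exact hno' s ⟨h3, h2⟩ hsP

/-- Chords of successive arcs of a short piece of a curve meet at most in a common endpoint. -/
theorem eq_of_mem_segment_of_mem_segment (hκ : 0 < κ) (hc : c.CurvatureLE κ) {s t s' t' : ℝ}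
    (hs : s ∈ c.dom) (ht' : t' ∈ c.dom) (hst : s ≤ t) (hts' : t ≤ s') (hst' : s' ≤ t')
    (hlen : κ * (t' - s) ≤ π) {x : Plane} (hx : x ∈ segment ℝ (c.toFun s) (c.toFun t))
    (hx' : x ∈ segment ℝ (c.toFun s') (c.toFun t')) : x = c.toFun t ∧ t = s' := by
  have hm : (s + t') / 2 ∈ c.dom := c.Icc_subset_dom hs ht' ⟨by linarith, by linarith⟩
  have hlt : ∀ u ∈ Icc s t', ∀ v ∈ Icc s t', u < v →
      0 < inner ℝ (c.toFun v - c.toFun u) (c.tangent ((s + t') / 2)) := by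
    intro u hu v hv huv
    have hw : ∀ w ∈ Icc s t', κ * |w - (s + t') / 2| ≤ π / 2 := fun w hw => by
      have h1 : |w - (s + t') / 2| ≤ (t' - s) / 2 :=
        abs_le.2 ⟨by linarith [hw.1], by linarith [hw.2]⟩
      have := mul_le_mul_of_nonneg_left h1 hκ.le
      linarith
    exact inner_tangent_pos hκ hc hm (c.Icc_subset_dom hs ht' hu) (c.Icc_subset_dom hs ht' hv) huv
      (hw u hu) (hw v hv)
  set T := c.tangent ((s + t') / 2) with hT
  have hle : ∀ u ∈ Icc s t', ∀ v ∈ Icc s t', u ≤ v →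
      0 ≤ inner ℝ (c.toFun v - c.toFun u) T := fun u hu v hv huv => by
    rcases huv.eq_or_lt with rfl | h
    · simp
    · exact (hlt u hu v hv h).le
  have ms : s ∈ Icc s t' := ⟨le_rfl, by linarith⟩
  have mt : t ∈ Icc s t' := ⟨hst, by linarith⟩
  have ms' : s' ∈ Icc s t' := ⟨by linarith, hst'⟩
  have mt' : t' ∈ Icc s t' := ⟨by linarith, le_rfl⟩
  obtain ⟨a, b, ha, hb, hab, rfl⟩ := hx
  obtain ⟨a', b', ha', hb', hab', he⟩ := hx'
  obtain rfl : b = 1 - a := by linarith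
  obtain rfl : a' = 1 - b' := by linarith
  -- Equating the two expressions for `x` makes three vectors with nonnegative projections to the
  -- middle tangent sum to zero. So each projection vanishes.
  have e1 : a • (c.toFun t - c.toFun s) + b' • (c.toFun t' - c.toFun s')
      + (c.toFun s' - c.toFun t) = 0 := by
    rw [← sub_eq_zero] at he
    rw [← he]
    module
  have e2 := congrArg (fun v => inner ℝ v T) e1
  simp only [inner_add_left, real_inner_smul_left, inner_zero_left] at e2
  have f1 := mul_nonneg ha (hle s ms t mt hst)
  have f2 := mul_nonneg hb' (hle s' ms' t' mt' hst')
  have f3 := hle t mt s' ms' hts'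
  constructor
  · rcases hst.eq_or_lt with rfl | h
    · module
    · have : a = 0 := by
        by_contra h0
        have := mul_pos (lt_of_le_of_ne ha (Ne.symm h0)) (hlt s ms t mt h)
        linarith
      rw [this]; module
  · by_contra h0
    have := hlt t mt s' ms' (lt_of_le_of_ne hts' h0)
    linarith

end PlaneCurve

/-! ### The common setting of both versions -/

open PlaneCurve NoiseFreePolygonalization

/-- A figure with samples as in the reconstruction theorem, where `B` assigns to a point the open or
closed ball of radius `ε` about it. -/
structure SampledFigure {M N : ℕ} (γ : Fin M → PlaneCurve) (p m : Fin N → Plane) (κ δ ε : ℝ)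
    (B : Plane → Set Plane) : Prop where
  κ_pos : 0 < κ
  curv : ∀ k, (γ k).CurvatureLE κ
  sep : FigureSeparated γ κ δ
  ends : EndpointsSeparated γ κ ε
  sample : IsSampleOf γ p m
  lt_δ : 2 * κ * ε ^ 2 < δ
  ε_lt : ε < 1 / (κ * √2)
  gap : ∀ k s t, (γ k).Consecutive (range p) s t → t - s ≤ ε
  dist_le : ∀ x y, x ∈ B y → dist x y ≤ ε
  mem_ball : ∀ k s t, (γ k).Consecutive (range p) s t →
    (γ k).toFun s ∈ B ((γ k).toFun t) ∧ (γ k).toFun t ∈ B ((γ k).toFun s)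

namespace SampledFigure

variable {M N : ℕ} {γ : Fin M → PlaneCurve} {p m : Fin N → Plane} {κ δ ε : ℝ}
  {B : Plane → Set Plane}

theorem mul_ε_le (F : SampledFigure γ p m κ δ ε B) : κ * ε ≤ π / 4 := by
  have hκ := F.κ_pos
  have h2 : √2 * √2 = 2 := mul_self_sqrt (by norm_num)
  have h1 : κ * (1 / (κ * √2)) = √2 / 2 := by field_simp; linarith
  have h3 : κ * ε ≤ √2 / 2 := h1 ▸ mul_le_mul_of_nonneg_left F.ε_lt.le hκ.le
  have h4 : √2 ≤ 3 / 2 := sqrt_le_iff.2 ⟨by norm_num, by norm_num⟩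
  linarith [pi_gt_three]

theorem δ_pos (F : SampledFigure γ p m κ δ ε B) : 0 < δ :=
  lt_of_le_of_lt (mul_nonneg (mul_nonneg two_pos.le F.κ_pos.le) (sq_nonneg ε)) F.lt_δ

/-- The integer selects a lift of the second parameter on a closed curve; on other curves the period
is `0`. -/
theorem eq_and_exists_of_dist_lt (F : SampledFigure γ p m κ δ ε B) {k l : Fin M} {s t : ℝ}
    (hs : s ∈ (γ k).dom) (ht : t ∈ (γ l).dom) (h : dist ((γ k).toFun s) ((γ l).toFun t) < δ) :
    k = l ∧ ∃ n : ℤ, κ * |s - (t + n * (γ k).period)| ≤ π / 2 := by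
  have hkl : k = l := by
    by_contra hne
    exact absurd (F.sep.1 k l hne s hs t ht) (not_le.2 h)
  subst hkl
  exact ⟨rfl, exists_int_of_not_farAlong F.κ_pos fun hf =>
    absurd (F.sep.2 k s hs t ht hf) (not_le.2 h)⟩

/-- The tangent directions prescribed at a sample do not depend on its parameter. -/
theorem tangent_of_toFun_eq (F : SampledFigure γ p m κ δ ε B) {k : Fin M} {s : ℝ}
    (hs : s ∈ (γ k).dom) {i : Fin N} (hi : (γ k).toFun s = p i) :
    ∃ τ : ℝ, (τ = 1 ∨ τ = -1) ∧ m i = τ • (γ k).tangent s := by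
  obtain ⟨l, t, ht, hti, hm⟩ := F.sample.2 i
  obtain ⟨rfl, n, hn⟩ := F.eq_and_exists_of_dist_lt hs ht
    (by rw [hi, hti, dist_self]; exact F.δ_pos)
  -- Two parameters of one point are close along the curve by separation, and a short nontrivial arc
  -- has a nonzero chord.
  have hst : t + n * (γ k).period = s := by
    by_contra hne
    have := norm_chord_pos F.κ_pos (F.curv k) ((γ k).add_int_mul_period_mem ht n) hs hne
      (by linarith [pi_pos])
    rw [(γ k).toFun_add_int_mul_period, hi, hti, sub_self, norm_zero] at this
    exact this.false
  rw [← hst, (γ k).tangent_add_int_mul_period]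
  rcases hm with hm | hm
  · exact ⟨1, Or.inl rfl, by simpa using hm⟩
  · exact ⟨-1, Or.inr rfl, by simpa using hm⟩

/-! ### The polygonalization is plane -/

/-- Both arcs pass within `κ * ε ^ 2 / 2` of the common point, so they come closer than `δ`.
Separation then leaves `π / (2 κ)` between the two nearby points, and the arcs add at most `2 * ε ≤
π / (2 κ)`. -/
theorem eq_and_exists_of_segments_meet (F : SampledFigure γ p m κ δ ε B) {k l : Fin M}
    {s t s' t' : ℝ} (hs : s ∈ (γ k).dom) (ht : t ∈ (γ k).dom) (hs' : s' ∈ (γ l).dom)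
    (ht' : t' ∈ (γ l).dom) (hst : s ≤ t) (hst' : s' ≤ t') (hε : t - s ≤ ε) (hε' : t' - s' ≤ ε)
    {x : Plane} (hx : x ∈ segment ℝ ((γ k).toFun s) ((γ k).toFun t))
    (hx' : x ∈ segment ℝ ((γ l).toFun s') ((γ l).toFun t')) :
    k = l ∧ ∃ n : ℤ, κ * ((t' + n * (γ k).period) - s) ≤ π ∧
      κ * (t - (s' + n * (γ k).period)) ≤ π := by
  have hκ := F.κ_pos
  obtain ⟨u, hu, hxu⟩ := exists_norm_sub_le_of_mem_segment hκ (F.curv k) hs ht hst hx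
  obtain ⟨v, hv, hxv⟩ := exists_norm_sub_le_of_mem_segment hκ (F.curv l) hs' ht' hst' hx'
  have hL : κ * (t - s) ^ 2 ≤ κ * ε ^ 2 := by gcongr
  have hL' : κ * (t' - s') ^ 2 ≤ κ * ε ^ 2 := by gcongr
  have hε2 : 0 ≤ κ * ε ^ 2 := mul_nonneg hκ.le (sq_nonneg ε)
  obtain ⟨rfl, n, hn⟩ := F.eq_and_exists_of_dist_lt ((γ k).Icc_subset_dom hs ht hu)
    ((γ l).Icc_subset_dom hs' ht' hv) (by
      have := dist_triangle_left ((γ k).toFun u) ((γ l).toFun v) x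
      linarith [F.lt_δ])
  refine ⟨rfl, n, ?_, ?_⟩
  · have h1 : (t' + n * (γ k).period) - s ≤ |u - (v + n * (γ k).period)| + 2 * ε := by
      have := neg_abs_le (u - (v + n * (γ k).period))
      linarith [hu.2, hv.1]
    have := mul_le_mul_of_nonneg_left h1 hκ.le
    linarith [F.mul_ε_le]
  · have h1 : t - (s' + n * (γ k).period) ≤ |u - (v + n * (γ k).period)| + 2 * ε := by
      have := le_abs_self (u - (v + n * (γ k).period))
      linarith [hu.1, hv.2]
    have := mul_le_mul_of_nonneg_left h1 hκ.le
    linarith [F.mul_ε_le]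

theorem isPlaneGraph (F : SampledFigure γ p m κ δ ε B) {Γ : SimpleGraph (Fin N)}
    (hΓ : ∀ i j, Γ.Adj i j → ∃ k s t, (γ k).Consecutive (range p) s t ∧
      ((γ k).toFun s = p i ∧ (γ k).toFun t = p j ∨ (γ k).toFun s = p j ∧ (γ k).toFun t = p i)) :
    IsPlaneGraph p Γ := by
  have hκ := F.κ_pos
  have hΓ' : ∀ i j, Γ.Adj i j → ∃ k s t, (γ k).Consecutive (range p) s t ∧
      segment ℝ (p i) (p j) = segment ℝ ((γ k).toFun s) ((γ k).toFun t) ∧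
      ({p i, p j} : Set Plane) = {(γ k).toFun s, (γ k).toFun t} := by
    intro i j hij
    obtain ⟨k, s, t, hC, ⟨h1, h2⟩ | ⟨h1, h2⟩⟩ := hΓ i j hij
    · exact ⟨k, s, t, hC, by rw [h1, h2], by rw [h1, h2]⟩
    · exact ⟨k, s, t, hC, by rw [h1, h2, segment_symm], by rw [h1, h2, pair_comm]⟩
  refine ⟨F.sample.1, ?_, ?_⟩
  · rintro a b c d hab hcd hne x ⟨hx, hx'⟩
    obtain ⟨k, s, t, hC, hseg, hpair⟩ := hΓ' a b hab
    obtain ⟨l, s', t', hC', hseg', hpair'⟩ := hΓ' c d hcd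
    rw [hseg] at hx
    rw [hseg'] at hx'
    obtain ⟨rfl, n, h1, h2⟩ := F.eq_and_exists_of_segments_meet hC.1 hC.2.1 hC'.1 hC'.2.1
      hC.2.2.1.le hC'.2.2.1.le (F.gap k s t hC) (F.gap _ s' t' hC') hx hx'
    have hC'' := hC'.add_int_mul_period n
    rw [← (γ k).toFun_add_int_mul_period s' n, ← (γ k).toFun_add_int_mul_period t' n] at hx' hpair'
    rw [hpair, hpair']
    rcases hC.eq_or_le_or_le hC'' with ⟨e1, e2⟩ | h | h
    · rw [← e1, ← e2, ← hpair, pair_eq_pair_iff] at hpair'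
      refine absurd (Sym2.eq_iff.2 ?_) hne
      rcases hpair' with ⟨g1, g2⟩ | ⟨g1, g2⟩
      · exact Or.inl ⟨(F.sample.1 g1).symm, (F.sample.1 g2).symm⟩
      · exact Or.inr ⟨(F.sample.1 g2).symm, (F.sample.1 g1).symm⟩
    · obtain ⟨g1, g2⟩ := eq_of_mem_segment_of_mem_segment hκ (F.curv k) hC.1 hC''.2.1 hC.2.2.1.le h
        hC''.2.2.1.le h1 hx hx'
      exact ⟨by simp [g1], by rw [g1, g2]; simp⟩
    · obtain ⟨g1, g2⟩ := eq_of_mem_segment_of_mem_segment hκ (F.curv k) hC''.1 hC.2.1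
        hC''.2.2.1.le h hC.2.2.1.le h2 hx' hx
      exact ⟨by rw [g1, g2]; simp, by simp [g1]⟩
  · intro a b v hab hx
    obtain ⟨k, s, t, hC, hseg, hpair⟩ := hΓ' a b hab
    rw [hseg] at hx
    obtain ⟨l, w, hw, hwv, -⟩ := F.sample.2 v
    -- The vertex is treated as a degenerate chord.
    have hx' : p v ∈ segment ℝ ((γ l).toFun w) ((γ l).toFun w) := by
      rw [segment_same, hwv]; rfl
    have hgap := F.gap k s t hC
    obtain ⟨rfl, n, h1, h2⟩ := F.eq_and_exists_of_segments_meet hC.1 hC.2.1 hw hw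
      hC.2.2.1.le le_rfl hgap (by linarith [hC.2.2.1]) hx hx'
    rw [← (γ k).toFun_add_int_mul_period w n] at hx' hwv
    have hw' := (γ k).add_int_mul_period_mem hw n
    set w' := w + n * (γ k).period
    have hmem : p v ∈ ({p a, p b} : Set Plane) := by
      rw [hpair]
      rcases le_or_gt t w' with h | h
      · obtain ⟨g1, -⟩ := eq_of_mem_segment_of_mem_segment hκ (F.curv k) hC.1 hw' hC.2.2.1.le h
          le_rfl h1 hx hx'
        simp [g1]
      · rcases le_or_gt w' s with h' | h'
        · obtain ⟨g1, g2⟩ := eq_of_mem_segment_of_mem_segment hκ (F.curv k) hw' hC.2.1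
            le_rfl h' hC.2.2.1.le h2 hx' hx
          rw [g1, g2]; simp
        · exact absurd ⟨v, hwv.symm⟩ (hC.2.2.2.2.2 w' ⟨h', h⟩)
    rcases hmem with h | h
    · exact Or.inl (F.sample.1 h)
    · exact Or.inr (F.sample.1 h)

/-! ### The candidates -/

/-- Samples that are in each other's allowed zones are close to each other along one curve. -/
theorem exists_of_edge (F : SampledFigure γ p m κ δ ε B) {k : Fin M} {s : ℝ}
    (hs : s ∈ (γ k).dom) {i j : Fin N} (hi : (γ k).toFun s = p i) (hij : p i ≠ p j)
    (hE : Edge κ B p m i j) :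
    ∃ t ∈ (γ k).dom, (γ k).toFun t = p j ∧ κ * |t - s| ≤ π / 2 := by
  have hκ := F.κ_pos
  obtain ⟨⟨hB, hZ⟩, -, hZ'⟩ := hE
  obtain ⟨l, t, ht, htj, -⟩ := F.sample.2 j
  have hzone : ∀ {q : Fin M} {r : ℝ} {a b : Fin N}, r ∈ (γ q).dom → (γ q).toFun r = p a →
      p b ∉ forbiddenZone κ (p a) (m a) →
      p b ∉ forbiddenZone κ ((γ q).toFun r) ((γ q).tangent r) := by
    intro q r a b hr ha hb
    obtain ⟨τ, rfl | rfl, hm⟩ := F.tangent_of_toFun_eq hr ha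
    · rwa [hm, one_smul, ← ha] at hb
    · rwa [hm, neg_one_smul, Plane.forbiddenZone_neg, ← ha] at hb
  have hd : dist ((γ k).toFun s) ((γ l).toFun t) ≤ ε := by
    rw [hi, htj]; exact F.dist_le _ _ hB
  have z₁ := hzone hs hi hZ'
  have z₂ := hzone ht htj hZ
  rw [← htj] at z₁
  rw [← hi] at z₂
  have hne : (γ k).toFun s ≠ (γ l).toFun t := by rwa [hi, htj]
  by_cases hcon : k = l
  · subst hcon
    by_cases hfar : (γ k).FarAlong (π / 2 * κ⁻¹) s t
    · exfalso
      have hfar' := fun s' t' => FarAlong.of_near hκ (F.curv k) (s' := s') (t' := t') F.ε_lt hs ht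
        hfar hd
      exact not_apart_of_mutually_allowed hκ (F.curv k) (F.curv k) F.lt_δ F.ε_lt hs ht hne hd z₁ z₂
        (fun s' m₁ t' m₂ h₁ h₂ => F.sep.2 k s' m₁ t' m₂ (hfar' s' t' h₁ h₂))
        (fun s' m₁ t' m₂ h₁ h₂ => F.ends k k s' m₁ t' m₂ (Or.inr (hfar' s' t' h₁ h₂)))
    · obtain ⟨n, hn⟩ := exists_int_of_not_farAlong hκ hfar
      exact ⟨_, (γ k).add_int_mul_period_mem ht n, by rw [(γ k).toFun_add_int_mul_period, htj],
        by rwa [abs_sub_comm]⟩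
  · exfalso
    exact not_apart_of_mutually_allowed hκ (F.curv k) (F.curv l) F.lt_δ F.ε_lt hs ht hne hd z₁ z₂
      (fun s' m₁ t' m₂ _ _ => F.sep.1 k l hcon s' m₁ t' m₂)
      (fun s' m₁ t' m₂ _ _ => F.ends k l s' m₁ t' m₂ (Or.inl hcon))

/-! ### Order along the curve and nearest tangential neighbours -/

theorem sign_mul {σ τ : ℝ} (hσ : σ = 1 ∨ σ = -1) (hτ : τ = 1 ∨ τ = -1) :
    σ * τ = 1 ∨ σ * τ = -1 := by
  rcases hσ with rfl | rfl <;> rcases hτ with rfl | rfl <;> simp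

theorem walk_inner_lt (F : SampledFigure γ p m κ δ ε B) {k : Fin M} {s ρ u v : ℝ}
    (hρ : ρ = 1 ∨ ρ = -1) (hs : s ∈ (γ k).dom) (hv : s + ρ * v ∈ (γ k).dom) (hu0 : 0 ≤ u)
    (huv : u < v) (hκv : κ * v ≤ π / 2) :
    ρ * inner ℝ ((γ k).toFun (s + ρ * u) - (γ k).toFun s) ((γ k).tangent s) <
      ρ * inner ℝ ((γ k).toFun (s + ρ * v) - (γ k).toFun s) ((γ k).tangent s) := by
  have hκ := F.κ_pos
  have hu := (γ k).add_mul_mem_dom hs hv ⟨hu0, huv.le⟩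
  have hκu : κ * u ≤ π / 2 := (mul_le_mul_of_nonneg_left huv.le hκ.le).trans hκv
  rw [← abs_walk_sub (s := s) hρ hu0] at hκu
  rw [← abs_walk_sub (s := s) hρ (hu0.trans huv.le)] at hκv
  rw [← sub_pos, ← mul_sub, ← inner_sub_left, sub_sub_sub_cancel_right]
  rcases hρ with rfl | rfl
  · rw [one_mul]
    exact inner_tangent_pos hκ (F.curv k) hs hu hv (by linarith) hκu hκv
  · have := inner_tangent_pos hκ (F.curv k) hs hv hu (by linarith) hκv hκu
    rw [← neg_sub, inner_neg_left] at this
    linarith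

/-- The candidates on one side of a sample lie on the same side along the curve. -/
theorem exists_of_mem_candidates (F : SampledFigure γ p m κ δ ε B) {k : Fin M} {s σ τ : ℝ}
    (hσ : σ = 1 ∨ σ = -1) (hτ : τ = 1 ∨ τ = -1) (hs : s ∈ (γ k).dom) {i j : Fin N}
    (hi : (γ k).toFun s = p i) (hm : m i = τ • (γ k).tangent s)
    (hj : j ∈ candidates κ B p m σ i) :
    ∃ u, 0 < u ∧ κ * u ≤ π / 2 ∧ s + σ * τ * u ∈ (γ k).dom ∧
      (γ k).toFun (s + σ * τ * u) = p j := by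
  obtain ⟨hE, hpos⟩ := hj
  have hij : p i ≠ p j := fun h => by simp [h] at hpos
  obtain ⟨t, ht, htj, htκ⟩ := F.exists_of_edge hs hi hij hE
  rw [hm, inner_smul_right, ← mul_assoc, ← htj, ← hi] at hpos
  have hρ := sign_mul hσ hτ
  set ρ := σ * τ
  have hρρ : ρ * ρ = 1 := by rcases hρ with h | h <;> rw [h] <;> norm_num
  -- Were the parameter on the other side of `s`, monotonicity would give the tangential coordinate
  -- the wrong sign.
  have e : ρ * (t - s) = |t - s| := by
    by_contra hne
    have e' : t = s + -ρ * |t - s| := by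
      rcases hρ with h | h <;> rw [h] at hne ⊢ <;> rcases abs_choice (t - s) with g | g <;>
        rw [g] at hne ⊢ <;> first | exact absurd (by ring1) hne | ring1
    have hts : t ≠ s := fun h => hne (by simp [h])
    have := F.walk_inner_lt (ρ := -ρ) (by rcases hρ with h | h <;> rw [h] <;> simp) hs (e' ▸ ht)
      le_rfl (abs_pos.2 (sub_ne_zero.2 hts)) htκ
    rw [← e', mul_zero, add_zero, sub_self, inner_zero_left] at this
    linarith
  have e' : t = s + ρ * |t - s| := by
    rw [← e, ← mul_assoc, hρρ]; ring
  refine ⟨|t - s|, abs_pos.2 (sub_ne_zero.2 fun h => hij (by rw [← hi, ← htj, h])), htκ, ?_, ?_⟩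
  · rwa [← e']
  · rwa [← e']

theorem mem_candidates (F : SampledFigure γ p m κ δ ε B) {k : Fin M} {s σ τ u : ℝ}
    (hσ : σ = 1 ∨ σ = -1) (hτ : τ = 1 ∨ τ = -1) (hs : s ∈ (γ k).dom) {i j : Fin N}
    (hi : (γ k).toFun s = p i) (hm : m i = τ • (γ k).tangent s) (hu : 0 < u)
    (hκu : κ * u ≤ π / 2) (hsu : s + σ * τ * u ∈ (γ k).dom)
    (hj : (γ k).toFun (s + σ * τ * u) = p j) (hB : p i ∈ B (p j)) (hB' : p j ∈ B (p i)) :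
    j ∈ candidates κ B p m σ i := by
  have hκ := F.κ_pos
  have hρ := sign_mul hσ hτ
  have habs := abs_walk_sub (s := s) hρ hu.le
  refine ⟨⟨⟨hB, ?_⟩, hB', ?_⟩, ?_⟩
  · obtain ⟨τ', hτ', hm'⟩ := F.tangent_of_toFun_eq hsu hj
    have := toFun_notMem_forbiddenZone hκ (F.curv k) hsu hs (by rwa [abs_sub_comm, habs])
    rw [hi, hj] at this
    rw [hm']
    rcases hτ' with rfl | rfl
    · rwa [one_smul]
    · rwa [neg_one_smul, Plane.forbiddenZone_neg]
  · have := toFun_notMem_forbiddenZone hκ (F.curv k) hs hsu (by rwa [habs])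
    rw [hi, hj] at this
    rw [hm]
    rcases hτ with rfl | rfl
    · rwa [one_smul]
    · rwa [neg_one_smul, Plane.forbiddenZone_neg]
  · have := F.walk_inner_lt hρ hs hsu le_rfl hu hκu
    rw [mul_zero, add_zero, sub_self, inner_zero_left, mul_zero] at this
    rwa [hm, inner_smul_right, ← mul_assoc, ← hi, ← hj]

theorem tangentialDist_lt (F : SampledFigure γ p m κ δ ε B) {k : Fin M} {s ρ τ u v : ℝ}
    (hρ : ρ = 1 ∨ ρ = -1) (hτ : τ = 1 ∨ τ = -1) (hs : s ∈ (γ k).dom) {i j l : Fin N}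
    (hi : (γ k).toFun s = p i) (hm : m i = τ • (γ k).tangent s) (hu : 0 < u) (huv : u < v)
    (hκv : κ * v ≤ π / 2) (hsv : s + ρ * v ∈ (γ k).dom) (hj : (γ k).toFun (s + ρ * u) = p j)
    (hl : (γ k).toFun (s + ρ * v) = p l) :
    tangentialDist (m i) (p j) (p i) < tangentialDist (m i) (p l) (p i) := by
  have h1 := F.walk_inner_lt hρ hs hsv hu.le huv hκv
  have h2 := F.walk_inner_lt hρ hs ((γ k).add_mul_mem_dom hs hsv ⟨hu.le, huv.le⟩) le_rfl hu
    ((mul_le_mul_of_nonneg_left huv.le F.κ_pos.le).trans hκv)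
  rw [mul_zero, add_zero, sub_self, inner_zero_left, mul_zero] at h2
  have habs : ∀ x : Plane, tangentialDist (m i) x (p i) =
      |ρ * inner ℝ (x - (γ k).toFun s) ((γ k).tangent s)| := fun x => by
    rw [tangentialDist, hm, inner_smul_right, hi, abs_mul, abs_mul]
    rcases hρ with rfl | rfl <;> rcases hτ with rfl | rfl <;> simp
  rw [habs, habs, ← hj, ← hl, abs_of_pos h2, abs_of_pos (h2.trans h1)]
  exact h1

/-- The parameters `s` and `s + ρ * u` belong to consecutive samples. -/
def ConsecutiveAlong (c : PlaneCurve) (P : Set Plane) (s ρ u : ℝ) : Prop :=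
  (ρ = 1 ∧ c.Consecutive P s (s + u)) ∨ (ρ = -1 ∧ c.Consecutive P (s - u) s)

/-- From a sample, the curve meets a next sample before or at any given later one. -/
theorem exists_consecutiveAlong (F : SampledFigure γ p m κ δ ε B) {k : Fin M} {s ρ u : ℝ}
    (hρ : ρ = 1 ∨ ρ = -1) (hs : s ∈ (γ k).dom) (hsP : (γ k).toFun s ∈ range p) (hu : 0 < u)
    (hκu : κ * u ≤ π / 2) (hsu : s + ρ * u ∈ (γ k).dom)
    (hsuP : (γ k).toFun (s + ρ * u) ∈ range p) :
    ∃ v, 0 < v ∧ v ≤ u ∧ (γ k).toFun (s + ρ * v) ∈ range p ∧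
      ConsecutiveAlong (γ k) (range p) s ρ v := by
  have hinj : InjOn (fun v => (γ k).toFun (s + ρ * v)) (Icc 0 u) := by
    intro v hv w hw hvw
    rcases lt_trichotomy v w with h | h | h
    · have := F.walk_inner_lt hρ hs ((γ k).add_mul_mem_dom hs hsu hw) hv.1 h
        ((mul_le_mul_of_nonneg_left hw.2 F.κ_pos.le).trans hκu)
      simp only at hvw
      rw [hvw] at this
      exact absurd this (lt_irrefl _)
    · exact h
    · have := F.walk_inner_lt hρ hs ((γ k).add_mul_mem_dom hs hsu hv) hw.1 h
        ((mul_le_mul_of_nonneg_left hv.2 F.κ_pos.le).trans hκu)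
      simp only at hvw
      rw [hvw] at this
      exact absurd this (lt_irrefl _)
  -- There are finitely many samples and the arc is injective, so a first sample parameter exists.
  have hfin : {v | v ∈ Ioc 0 u ∧ (γ k).toFun (s + ρ * v) ∈ range p}.Finite :=
    Finite.of_injOn (f := fun v => (γ k).toFun (s + ρ * v)) (fun v hv => hv.2)
      (hinj.mono fun v hv => Ioc_subset_Icc_self hv.1) (finite_range p)
  obtain ⟨v, ⟨hv, hvP⟩, hmin⟩ := exists_min_image _ id hfin ⟨u, ⟨hu, le_rfl⟩, hsuP⟩
  have hno : ∀ w ∈ Ioo 0 v, (γ k).toFun (s + ρ * w) ∉ range p := fun w hw hwP =>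
    absurd (hmin w ⟨⟨hw.1, hw.2.le.trans hv.2⟩, hwP⟩) (not_le.2 hw.2)
  have hvd := (γ k).add_mul_mem_dom hs hsu (Ioc_subset_Icc_self hv)
  refine ⟨v, hv.1, hv.2, hvP, ?_⟩
  rcases hρ with rfl | rfl
  · rw [one_mul] at hvd hvP
    refine Or.inl ⟨rfl, hs, hvd, by linarith [hv.1], hsP, hvP, fun w hw => ?_⟩
    have := hno (w - s) ⟨by linarith [hw.1], by linarith [hw.2]⟩
    rwa [show s + 1 * (w - s) = w by ring] at this
  · rw [neg_one_mul, ← sub_eq_add_neg] at hvd hvP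
    refine Or.inr ⟨rfl, hvd, hs, by linarith [hv.1], hvP, hsP, fun w hw => ?_⟩
    have := hno (s - w) ⟨by linarith [hw.2], by linarith [hw.1]⟩
    rwa [show s + -1 * (s - w) = w by ring] at this

theorem gap_along (F : SampledFigure γ p m κ δ ε B) {k : Fin M} {s ρ u : ℝ}
    (h : ConsecutiveAlong (γ k) (range p) s ρ u) :
    u ≤ ε ∧ (γ k).toFun s ∈ B ((γ k).toFun (s + ρ * u)) ∧
      (γ k).toFun (s + ρ * u) ∈ B ((γ k).toFun s) := by
  rcases h with ⟨rfl, h⟩ | ⟨rfl, h⟩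
  · have h1 := F.gap _ _ _ h
    have h2 := F.mem_ball _ _ _ h
    rw [one_mul]
    exact ⟨by linarith, h2⟩
  · have h1 := F.gap _ _ _ h
    have h2 := F.mem_ball _ _ _ h
    rw [neg_one_mul, ← sub_eq_add_neg]
    exact ⟨by linarith, h2.symm⟩

/-- A nearest tangential neighbour is an adjacent sample. -/
theorem consecutive_of_isArgmin (F : SampledFigure γ p m κ δ ε B) {σ : ℝ} (hσ : σ = 1 ∨ σ = -1)
    {r : Fin N → Option (Fin N)} (hr : IsArgmin κ B p m σ r) {i j : Fin N} (hij : r i = some j) :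
    ∃ k s t, (γ k).Consecutive (range p) s t ∧
      ((γ k).toFun s = p i ∧ (γ k).toFun t = p j ∨
        (γ k).toFun s = p j ∧ (γ k).toFun t = p i) := by
  have hκ := F.κ_pos
  obtain ⟨hj, hmin⟩ := (hr i).2 j hij
  obtain ⟨k, s, hs, hsi, -⟩ := F.sample.2 i
  obtain ⟨τ, hτ, hm⟩ := F.tangent_of_toFun_eq hs hsi
  have hρ := sign_mul hσ hτ
  obtain ⟨u, hu, hκu, hsu, huj⟩ := F.exists_of_mem_candidates hσ hτ hs hsi hm hj
  obtain ⟨v, hv, hvu, ⟨l, hl⟩, hC⟩ :=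
    F.exists_consecutiveAlong hρ hs ⟨i, hsi.symm⟩ hu hκu hsu ⟨j, huj.symm⟩
  obtain ⟨hvε, hB, hB'⟩ := F.gap_along hC
  rw [hsi, ← hl] at hB hB'
  have hvd := (γ k).add_mul_mem_dom hs hsu ⟨hv.le, hvu⟩
  have hlc := F.mem_candidates hσ hτ hs hsi hm hv
    ((mul_le_mul_of_nonneg_left hvu hκ.le).trans hκu) hvd hl.symm hB hB'
  -- An earlier sample would be a candidate at strictly smaller tangential distance.
  obtain rfl : v = u := by
    by_contra hne
    exact absurd (hmin l hlc) (not_le.2 (F.tangentialDist_lt hρ hτ hs hsi hm hv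
      (lt_of_le_of_ne hvu hne) hκu hsu hl.symm huj))
  rcases hC with ⟨h1, hC⟩ | ⟨h1, hC⟩
  · rw [h1, one_mul] at huj
    exact ⟨k, _, _, hC, Or.inl ⟨hsi, huj⟩⟩
  · rw [h1, neg_one_mul, ← sub_eq_add_neg] at huj
    exact ⟨k, _, _, hC, Or.inr ⟨huj, hsi⟩⟩

/-- The next sample along the curve is found as a nearest tangential neighbour. -/
theorem isArgmin_of_consecutive (F : SampledFigure γ p m κ δ ε B) {rpos rneg : Fin N → Option (Fin N)}
    (hpos : IsArgmin κ B p m 1 rpos) (hneg : IsArgmin κ B p m (-1) rneg) {i j : Fin N}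
    {k : Fin M} {s t : ℝ} (hC : (γ k).Consecutive (range p) s t) (hsi : (γ k).toFun s = p i)
    (htj : (γ k).toFun t = p j) : rpos i = some j ∨ rneg i = some j := by
  have hκ := F.κ_pos
  have hgap := F.gap k s t hC
  obtain ⟨hB, hB'⟩ := F.mem_ball k s t hC
  obtain ⟨hs, ht, hst, -, -, hno⟩ := hC
  rw [hsi, htj] at hB hB'
  obtain ⟨τ, hτ, hm⟩ := F.tangent_of_toFun_eq hs hsi
  have hττ : τ * τ = 1 := by rcases hτ with h | h <;> rw [h] <;> norm_num
  -- The side of `m i` is chosen as `τ`, so that it corresponds to increasing parameters.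
  have hst' : s + τ * τ * (t - s) = t := by rw [hττ]; ring
  have hκu : κ * (t - s) ≤ π / 2 :=
    (mul_le_mul_of_nonneg_left hgap hκ.le).trans (by linarith [F.mul_ε_le, pi_pos])
  have hjc : j ∈ candidates κ B p m τ i := F.mem_candidates hτ hτ hs hsi hm (by linarith) hκu
    (by rwa [hst']) (by rwa [hst']) hB hB'
  have key : ∀ r : Fin N → Option (Fin N), IsArgmin κ B p m τ r → r i = some j := by
    intro r hr
    match hl : r i with
    | none =>
      rw [(hr i).1 hl] at hjc
      exact absurd hjc (notMem_empty j)
    | some l =>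
      obtain ⟨hlc, hmin⟩ := (hr i).2 l hl
      obtain ⟨u, hu, hκu', hsu, hul⟩ := F.exists_of_mem_candidates hτ hτ hs hsi hm hlc
      rw [hττ] at hsu hul
      have e : s + 1 * (t - s) = t := by ring
      have hle : u ≤ t - s := by
        by_contra! hlt
        exact absurd (hmin j hjc) (not_le.2 (F.tangentialDist_lt (Or.inl rfl) hτ hs hsi hm
          (by linarith) hlt hκu' hsu (by rwa [e]) hul))
      have hge : t - s ≤ u := by
        by_contra! hlt
        exact hno (s + 1 * u) ⟨by linarith, by linarith⟩ ⟨l, hul.symm⟩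
      rw [le_antisymm hle hge, e, htj] at hul
      rw [F.sample.1 hul]
  rcases hτ with rfl | rfl
  · exact Or.inl (key rpos hpos)
  · exact Or.inr (key rneg hneg)

end SampledFigure

/-! ### Existence of an output and conclusion -/

theorem NoiseFreePolygonalization.exists_isArgmin {N : ℕ} (κ : ℝ) (B : Plane → Set Plane)
    (p m : Fin N → Plane) (σ : ℝ) : ∃ r, IsArgmin κ B p m σ r := by
  have h : ∀ i, ∃ o : Option (Fin N), (o = none → candidates κ B p m σ i = ∅) ∧
      ∀ j, o = some j → j ∈ candidates κ B p m σ i ∧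
        ∀ l ∈ candidates κ B p m σ i,
          tangentialDist (m i) (p j) (p i) ≤ tangentialDist (m i) (p l) (p i) := by
    intro i
    rcases (candidates κ B p m σ i).eq_empty_or_nonempty with h | h
    · exact ⟨none, fun _ => h, fun j hj => by simp at hj⟩
    · obtain ⟨j, hj, hmin⟩ := exists_min_image _
        (fun j => tangentialDist (m i) (p j) (p i)) (toFinite _) h
      refine ⟨some j, fun h => by simp at h, fun j' hj' => ?_⟩
      obtain rfl := Option.some.inj hj'
      exact ⟨hj, hmin⟩
  choose r hr using h
  exact ⟨r, hr⟩

theorem SampledFigure.correct {M N : ℕ} {γ : Fin M → PlaneCurve} {p m : Fin N → Plane}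
    {κ δ ε : ℝ} {B : Plane → Set Plane} (F : SampledFigure γ p m κ δ ε B) :
    Correct κ B p m γ := by
  obtain ⟨r₁, hr₁⟩ := exists_isArgmin κ B p m 1
  obtain ⟨r₂, hr₂⟩ := exists_isArgmin κ B p m (-1)
  refine ⟨⟨_, r₁, r₂, hr₁, hr₂, rfl⟩, ?_⟩
  rintro Γ ⟨rpos, rneg, hpos, hneg, rfl⟩
  have hadj : ∀ i j, (SimpleGraph.fromRel fun i j => rpos i = some j ∨ rneg i = some j).Adj i j ↔
      i ≠ j ∧ ∃ k s t, (γ k).Consecutive (range p) s t ∧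
        ((γ k).toFun s = p i ∧ (γ k).toFun t = p j ∨
          (γ k).toFun s = p j ∧ (γ k).toFun t = p i) := by
    intro i j
    rw [SimpleGraph.fromRel_adj]
    refine and_congr_right fun _ => ⟨?_, ?_⟩
    · rintro ((h | h) | (h | h))
      · exact F.consecutive_of_isArgmin (Or.inl rfl) hpos h
      · exact F.consecutive_of_isArgmin (Or.inr rfl) hneg h
      · obtain ⟨k, s, t, hC, h'⟩ := F.consecutive_of_isArgmin (Or.inl rfl) hpos h
        exact ⟨k, s, t, hC, h'.symm⟩
      · obtain ⟨k, s, t, hC, h'⟩ := F.consecutive_of_isArgmin (Or.inr rfl) hneg h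
        exact ⟨k, s, t, hC, h'.symm⟩
    -- It suffices that the sample at the start of the arc selects the one at its end, since
    -- `SimpleGraph.fromRel` symmetrizes.
    · rintro ⟨k, s, t, hC, ⟨h1, h2⟩ | ⟨h1, h2⟩⟩
      · exact Or.inl (F.isArgmin_of_consecutive hpos hneg hC h1 h2)
      · exact Or.inr (F.isArgmin_of_consecutive hpos hneg hC h1 h2)
  refine ⟨F.isPlaneGraph fun i j h => ((hadj i j).1 h).2, fun i => ?_, hadj⟩
  obtain ⟨k, t, ht, hti, -⟩ := F.sample.2 i
  exact ⟨k, t, ht, hti⟩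

theorem mainTheorem1 {M N : ℕ} (γ : Fin M → PlaneCurve) (p m : Fin N → Plane) (κ δ ε : ℝ)
    (hκ : 0 < κ) (hε : 0 < ε)
    (hcurv : ∀ k, (γ k).CurvatureLE κ)
    (hsep : FigureSeparated γ κ δ)
    (hends : EndpointsSeparated γ κ ε)
    (hsample : IsSampleOf γ p m)
    (hδ : 2 * κ * ε ^ 2 < δ)
    (hεκ : ε < 1 / (κ * √2)) :
    ((∀ k s t, (γ k).Consecutive (Set.range p) s t → t - s < ε) →
      NoiseFreePolygonalization.Correct κ (fun q => Metric.ball q ε) p m γ) ∧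
    ((∀ k s t, (γ k).Consecutive (Set.range p) s t → t - s ≤ ε) →
      NoiseFreePolygonalization.Correct κ (fun q => Metric.closedBall q ε) p m γ) := by
  have hchord : ∀ k s t, (γ k).Consecutive (Set.range p) s t →
      dist ((γ k).toFun t) ((γ k).toFun s) ≤ t - s := fun k s t hC => by
    rw [dist_eq_norm]
    exact (γ k).norm_chord_le hC.1 hC.2.1 hC.2.2.1.le
  constructor
  · intro hgap
    refine SampledFigure.correct (δ := δ) (ε := ε) ⟨hκ, hcurv, hsep, hends, hsample, hδ, hεκ,
      fun k s t hC => (hgap k s t hC).le, fun x y hx => (Metric.mem_ball.1 hx).le,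
      fun k s t hC => ?_⟩
    have := (hchord k s t hC).trans_lt (hgap k s t hC)
    exact ⟨Metric.mem_ball'.2 this, Metric.mem_ball.2 this⟩
  · intro hgap
    refine SampledFigure.correct (δ := δ) (ε := ε) ⟨hκ, hcurv, hsep, hends, hsample, hδ, hεκ,
      hgap, fun x y hx => Metric.mem_closedBall.1 hx, fun k s t hC => ?_⟩
    have := (hchord k s t hC).trans (hgap k s t hC)
    exact ⟨Metric.mem_closedBall'.2 this, Metric.mem_closedBall.2 this⟩
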